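/- A machine is a partial computable function $U$ that maps a pair of binary strings (a program $p$ and a condition $y$) to a binary string. For a machine $U$ and binary strings $x,y$, let $C_U(x\mid y)=\min\{|p| : U(p,y)=x\}$ (with $\min\emptyset=\infty$). The machine is prefix-free if, whenever $U(p,y)$ halts, $U(q,y)$ halts for no proper prefix $q$ of $p$. A machine $U$ is optimal if for every machine $W$ there is a constant $c_W$ with $C_U(x\mid y)\le C_W(x\mid y)+c_W$ for all $x,y$; an optimal prefix-free machine is a prefix-free machine $V$ with this property relative to all prefix-free machines $W$. Fix an optimal machine $U$ and an optimal prefix-free machine $V$. Write $C(x\mid y)=C_U(x\mid y)$ (plain complexity), $K(x\mid y)=C_V(x\mid y)$ (prefix-free complexity), and $K(x)=K(x\mid\text{empty string})$; $K$ and $C$ take only finite values. Natural numbers are identified with their binary expansions when they are described by programs, and $\log$ is the logarithm to base $2$. **Theorem.** There is a constant $c$ such that for every $n$ there is a binary string $x$ of length $n$ with $$C(K(x)\mid x)\ \ge\ \log n-c\qquad\text{and}\qquad K(x)\ \ge\ n/2,$$ and such that, consequently, also $K(K(x)\mid x)\ge \log n-c$. (For $n=0$ the two inequalities that contain $\log n$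 impose no condition.) -/

import Mathlib

namespace Kolmogorov

/-- A machine maps a program `p` and a condition `y` to an output, if it halts on `(p, y)`.
It is a machine proper only if it is computable (see `IsOptimal` and `IsPrefixOptimal`). -/
abbrev Machine : Type := List Bool → List Bool →. List Bool

/-- For every condition `y`, no program on which `U` halts is a proper prefix of another one. -/
def PrefixFree (U : Machine) : Prop :=
  ∀ y p q : List Bool, (U p y).Dom → (U q y).Dom → q <+: p → q = p

/-- `complexity U x y` is the least length of a program `p` with `U(p, y) = x`
(it is `⊤` if there is no such program). -/
noncomputable def complexity (U : Machine) (x y : List Bool) : ℕ∞ :=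
  ⨅ (p : List Bool) (_ : x ∈ U p y), (p.length : ℕ∞)

/-- A computable machine whose complexity is minimal, up to an additive constant, among all
computable machines. -/
def IsOptimal (U : Machine) : Prop :=
  Partrec₂ U ∧ ∀ W : Machine, Partrec₂ W →
    ∃ c : ℕ, ∀ x y : List Bool, complexity U x y ≤ complexity W x y + c

/-- A computable prefix-free machine whose complexity is minimal, up to an additive constant,
among all computable prefix-free machines. -/
def IsPrefixOptimal (V : Machine) : Prop :=
  Partrec₂ V ∧ PrefixFree V ∧ ∀ W : Machine, Partrec₂ W → PrefixFree W →
    ∃ c : ℕ, ∀ x y : List Bool, complexity V x y ≤ complexity W x y + c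

end Kolmogorov

/-!
Fix the length `n`, suppose that the programs for strings of length `n` have total weight about
`2 ^ (-s)`, and play a game with `2 ^ L` stages, where `2 ^ L` is `n` up to a constant factor. Every
stage has a range of complexities of constant width, and the ranges descend, disjointly, within the
upper half of the possible values. All strings are in play at first; at every stage, short
prefix-free programs are requested for the strings in play, just short enough to keep their
complexities below the upper end of the range. If all strings in play leave the range through its
lower end, or are hit (given the string, a program shorter than `L - 1` outputs a number in the
range), then a constant fraction of the strings, preferably hit ones, goes on to the next stage,
where a smaller number of strings permits longer programs at the same total weight.

A completed stage is cheap (at least half as many strings as were in play have complexities below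
the range, which uses up a share of the weight `2 ^ (-s)`, so at most half of the stages are cheap)
or all strings that went on were hit. Since the ranges are disjoint, there are fewer than
`2 ^ (L - 1)` stages at which a given string is hit. Hence the game gets stuck at some stage, and a
string that prevents its completion has its complexity in the range and is not hit: `C(K(x) | x)` is
at least `L - 1`.

The games for all `n` and `s` have requests of finite total weight, so the Kraft–Chaitin theorem
provides the programs, up to an additive constant. As the width of the ranges depends on that
constant, the games for all its possible values are played at once.
-/

open scoped ENNReal

namespace Kolmogorov

/-! ### Binary strings -/

/-- The list of all binary strings of length `n`. -/
def strings : ℕ → List (List Bool)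
  | 0 => [[]]
  | n + 1 => (strings n).map (List.cons false) ++ (strings n).map (List.cons true)

theorem mem_strings {n : ℕ} {p : List Bool} : p ∈ strings n ↔ p.length = n := by
  induction n generalizing p with
  | zero => simp [strings]
  | succ n ih =>
    rcases p with _ | ⟨b, p⟩
    · simp [strings]
    · cases b <;> simp [strings, ih]

theorem nodup_strings (n : ℕ) : (strings n).Nodup := by
  induction n with
  | zero => exact List.nodup_singleton []
  | succ n ih =>
    refine List.Nodup.append (ih.map List.cons_injective) (ih.map List.cons_injective) ?_
    intro p hfalse htrue
    obtain ⟨_, _, rfl⟩ := List.mem_map.1 hfalse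
    obtain ⟨_, _, h⟩ := List.mem_map.1 htrue
    simp at h

theorem length_strings (n : ℕ) : (strings n).length = 2 ^ n := by
  induction n with
  | zero => rfl
  | succ n ih => simp only [strings, List.length_append, List.length_map, ih, pow_succ, mul_two]

/-- The list of all binary strings of length less than `b`. -/
def shortStrings (b : ℕ) : List (List Bool) := (List.range b).flatMap strings

theorem mem_shortStrings {b : ℕ} {p : List Bool} : p ∈ shortStrings b ↔ p.length < b := by
  simp [shortStrings, mem_strings]

theorem length_shortStrings_add_one (b : ℕ) : (shortStrings b).length + 1 = 2 ^ b := by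
  induction b with
  | zero => rfl
  | succ b ih =>
    have hsucc : shortStrings (b + 1) = shortStrings b ++ strings b := by
      simp [shortStrings, List.range_succ]
    rw [hsucc, List.length_append, length_strings, pow_succ]
    omega

theorem card_lt_two_pow {b : ℕ} {F : Finset (List Bool)} (h : ∀ p ∈ F, p.length < b) :
    F.card < 2 ^ b := by
  have hF : F ⊆ (shortStrings b).toFinset := fun p hp =>
    List.mem_toFinset.2 (mem_shortStrings.2 (h p hp))
  have := (Finset.card_le_card hF).trans (List.toFinset_card_le _)
  have := length_shortStrings_add_one b
  omega

/-- The number with binary expansion `p`, least significant bit first. -/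
def lsbVal (p : List Bool) : ℕ := Nat.ofDigits 2 (p.map Bool.toNat)

theorem lsbVal_bits (k : ℕ) : lsbVal k.bits = k := by
  have h : k.bits.map Bool.toNat = Nat.digits 2 k := (Nat.digits_two_eq_bits k).symm
  rw [lsbVal, h, Nat.ofDigits_digits]

/-- The number with binary expansion `p`, most significant bit first. -/
def msbVal (p : List Bool) : ℕ := lsbVal p.reverse

theorem msbVal_append (p r : List Bool) :
    msbVal (p ++ r) = msbVal p * 2 ^ r.length + msbVal r := by
  simp only [msbVal, lsbVal, List.reverse_append, List.map_append, Nat.ofDigits_append,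
    List.length_map, List.length_reverse]
  ring

theorem msbVal_lt_two_pow (p : List Bool) : msbVal p < 2 ^ p.length := by
  have h := Nat.ofDigits_lt_base_pow_length (b := 2) (l := p.reverse.map Bool.toNat) one_lt_two
    fun d hd => by
      obtain ⟨b, _, rfl⟩ := List.mem_map.1 hd
      exact b.toNat_lt
  simpa [msbVal, lsbVal] using h

theorem exists_msbVal_eq {l q : ℕ} (h : q < 2 ^ l) :
    ∃ p : List Bool, p.length = l ∧ msbVal p = q := by
  induction l generalizing q with
  | zero => exact ⟨[], rfl, (Nat.lt_one_iff.1 h).symm⟩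
  | succ l ih =>
    obtain ⟨p, hp, hq⟩ := ih (q := q / 2) (by rw [pow_succ] at h; omega)
    refine ⟨p ++ [decide (q % 2 = 1)], by simp [hp], ?_⟩
    have hbit : msbVal [decide (q % 2 = 1)] = q % 2 := by
      rcases Nat.mod_two_eq_zero_or_one q with h2 | h2 <;> simp [msbVal, lsbVal, h2]
    rw [msbVal_append, hq, hbit, List.length_singleton, pow_one]
    omega

/-- The half-open interval of the numbers in `[0, 1)` whose binary expansion starts with `p`. -/
def dyadicCell (p : List Bool) : Set ℝ :=
  Set.Ico (msbVal p / 2 ^ p.length) ((msbVal p + 1) / 2 ^ p.length)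

theorem left_mem_dyadicCell (p : List Bool) : (msbVal p / 2 ^ p.length : ℝ) ∈ dyadicCell p :=
  Set.left_mem_Ico.2 (by gcongr; linarith)

theorem dyadicCell_subset_of_prefix {q p : List Bool} (h : q <+: p) :
    dyadicCell p ⊆ dyadicCell q := by
  obtain ⟨r, rfl⟩ := h
  have hr : (msbVal r : ℝ) + 1 ≤ 2 ^ r.length := by exact_mod_cast msbVal_lt_two_pow r
  refine Set.Ico_subset_Ico ?_ ?_ <;>
    rw [div_le_div_iff₀ (by positivity) (by positivity), msbVal_append, List.length_append,
      pow_add] <;> push_cast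
  · nlinarith [show (0 : ℝ) ≤ msbVal r * 2 ^ q.length by positivity]
  · nlinarith [mul_le_mul_of_nonneg_left hr (by positivity : (0 : ℝ) ≤ 2 ^ q.length)]

/-! ### Primitive recursive functions -/

section Primrec

variable {α β : Type*} [Primcodable α] [Primcodable β] {f : α → List β} {R : α → β → Prop}

theorem primrecPred_exists_mem (hf : Primrec f) (hR : PrimrecRel R) :
    PrimrecPred fun a => ∃ b ∈ f a, R a b :=
  hR.swap.exists_mem_list.comp hf Primrec.id

theorem primrecPred_forall_mem (hf : Primrec f) (hR : PrimrecRel R) :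
    PrimrecPred fun a => ∀ b ∈ f a, R a b :=
  hR.swap.forall_mem_list.comp hf Primrec.id

theorem primrec_filter [∀ a, DecidablePred (R a)] (hf : Primrec f) (hR : PrimrecRel R) :
    Primrec fun a => (f a).filter fun b => R a b := by
  have : DecidableRel (Function.swap R) := fun b a => inferInstanceAs (Decidable (R a b))
  exact (hR.swap.listFilter.comp hf Primrec.id).of_eq fun _ =>
    List.filter_congr fun _ _ => decide_eq_decide.2 Iff.rfl

open Primrec

theorem primrec_sum : Primrec (List.sum : List ℕ → ℕ) :=
  (list_foldr .id (const 0)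
    (nat_add.comp (fst.comp snd) (snd.comp snd)).to₂).of_eq fun _ => List.sum_eq_foldr.symm

theorem primrec_two_pow : Primrec fun k : ℕ => 2 ^ k :=
  (Primrec₂.unpaired'.1 Nat.Primrec.pow).comp (const 2) .id

theorem primrec_log_two : Primrec (Nat.log 2) := by
  have h : PrimrecRel fun n k : ℕ => 2 ^ k ≤ n :=
    (nat_le.comp (primrec_two_pow.comp snd) fst).primrecRel
  refine (nat_findGreatest (f := fun n : ℕ => n) .id h).of_eq fun n => ?_
  rw [Nat.findGreatest_eq_iff]
  rcases Nat.eq_zero_or_pos n with rfl | hn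
  · simp
  · exact ⟨(Nat.log_lt_self 2 hn.ne').le, fun _ => Nat.pow_log_le_self 2 hn.ne', fun k hk _ =>
      not_le.2 (Nat.lt_pow_of_log_lt one_lt_two hk)⟩

theorem primrec_strings : Primrec strings := by
  have hcons (b : Bool) : Primrec₂ fun (_ : ℕ × List (List Bool)) (l : List Bool) => b :: l :=
    list_cons.comp (const b) snd
  have hstep : Primrec₂ fun (_ : ℕ) (l : List (List Bool)) =>
      l.map (List.cons false) ++ l.map (List.cons true) :=
    list_append.comp (list_map snd (hcons false)) (list_map snd (hcons true))
  refine (nat_rec₁ [[]] hstep).of_eq fun n => ?_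
  induction n with
  | zero => rfl
  | succ n ih => simp only [strings, ← ih]

theorem primrec_shortStrings : Primrec shortStrings :=
  list_flatMap list_range (primrec_strings.comp snd).to₂

theorem primrec_lsbVal : Primrec lsbVal := by
  have hstep : Primrec₂ fun (_ : List Bool) (q : Bool × ℕ) => q.1.toNat + 2 * q.2 :=
    nat_add.comp ((dom_bool Bool.toNat).comp (fst.comp snd)) (nat_mul.comp (const 2) (snd.comp snd))
  refine (list_foldr .id (const 0) hstep).of_eq fun p => ?_
  simp only [lsbVal, Nat.ofDigits_eq_foldr, List.foldr_map, Nat.cast_id]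
  rfl

theorem primrec_msbVal : Primrec msbVal := primrec_lsbVal.comp list_reverse

end Primrec

/-! ### Machines and their approximations -/

/-- A primitive recursive approximation of a machine `U` from below: `run t p y` is the output of
`U` on `(p, y)` if it is found within `t` steps. -/
structure Approximation (U : Machine) where
  run : ℕ → List Bool → List Bool → Option (List Bool)
  primrec_run : Primrec fun q : ℕ × List Bool × List Bool => run q.1 q.2.1 q.2.2
  mono : ∀ {s t p y x}, s ≤ t → run s p y = some x → run t p y = some x
  mem_iff : ∀ {p y x}, x ∈ U p y ↔ ∃ t, run t p y = some x

theorem nonempty_approximation {U : Machine} (hU : Partrec₂ U) : Nonempty (Approximation U) := by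
  obtain ⟨c, hc⟩ := Nat.Partrec.Code.exists_code.1 hU
  refine ⟨fun t p y => (c.evaln t (Encodable.encode (p, y))).bind Encodable.decode, ?_, ?_, ?_⟩
  · refine Primrec.option_bind ?_ (Primrec.decode.comp Primrec.snd)
    exact Nat.Partrec.Code.primrec_evaln.comp
      (Primrec.pair (Primrec.pair Primrec.fst (Primrec.const c)) (Primrec.encode.comp Primrec.snd))
  · intro s t p y x hst h
    obtain ⟨k, hk, hx⟩ := Option.bind_eq_some_iff.1 h
    exact Option.bind_eq_some_iff.2 ⟨k, Nat.Partrec.Code.evaln_mono hst hk, hx⟩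
  · intro p y x
    have hmem (k : ℕ) :
        k ∈ c.eval (Encodable.encode (p, y)) ↔ ∃ z ∈ U p y, Encodable.encode z = k := by
      simp [hc]
    constructor
    · intro hx
      obtain ⟨t, ht⟩ := Nat.Partrec.Code.evaln_complete.1 ((hmem _).2 ⟨x, hx, rfl⟩)
      exact ⟨t, Option.bind_eq_some_iff.2 ⟨_, ht, Encodable.encodek x⟩⟩
    · rintro ⟨t, ht⟩
      obtain ⟨k, hk, hx⟩ := Option.bind_eq_some_iff.1 ht
      obtain ⟨z, hz, rfl⟩ := (hmem k).1 (Nat.Partrec.Code.evaln_sound hk)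
      rw [Encodable.encodek, Option.some_inj] at hx
      exact hx ▸ hz

theorem complexity_le_of_mem {U : Machine} {x y p : List Bool} (h : x ∈ U p y) :
    complexity U x y ≤ p.length := iInf₂_le p h

theorem complexity_le_natCast_iff {U : Machine} {x y : List Bool} {k : ℕ} :
    complexity U x y ≤ k ↔ ∃ p, x ∈ U p y ∧ p.length ≤ k := by
  refine ⟨fun h => ?_, fun ⟨p, hx, hp⟩ => (complexity_le_of_mem hx).trans (by exact_mod_cast hp)⟩
  have hlt : complexity U x y < ((k + 1 : ℕ) : ℕ∞) :=
    h.trans_lt (by exact_mod_cast Nat.lt_succ_self k)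
  obtain ⟨p, hp⟩ := iInf_lt_iff.1 hlt
  obtain ⟨hx, hpk⟩ := iInf_lt_iff.1 hp
  exact ⟨p, hx, Nat.lt_succ_iff.1 (by exact_mod_cast hpk)⟩

/-! ### Requests for prefix-free programs -/

theorem inv_two_pow_mul_two_pow (k : ℕ) : (2⁻¹ ^ k : ℝ≥0∞) * 2 ^ k = 1 := by
  rw [← mul_pow, ENNReal.inv_mul_cancel two_ne_zero ENNReal.ofNat_ne_top, one_pow]

theorem natCast_mul_inv_two_pow_le_iff {a b k l : ℕ} :
    (a : ℝ≥0∞) * 2⁻¹ ^ k ≤ b * 2⁻¹ ^ l ↔ a * 2 ^ l ≤ b * 2 ^ k := by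
  have hne : ((2 : ℝ≥0∞) ^ (k + l)) ≠ 0 := by positivity
  have htop : ((2 : ℝ≥0∞) ^ (k + l)) ≠ ∞ := by finiteness
  have hleft : (a : ℝ≥0∞) * 2⁻¹ ^ k * 2 ^ (k + l) = (a * 2 ^ l : ℕ) := by
    rw [pow_add, mul_assoc, ← mul_assoc (2⁻¹ ^ k), inv_two_pow_mul_two_pow]
    push_cast; ring
  have hright : (b : ℝ≥0∞) * 2⁻¹ ^ l * 2 ^ (k + l) = (b * 2 ^ k : ℕ) := by
    rw [add_comm, pow_add, mul_assoc, ← mul_assoc (2⁻¹ ^ l), inv_two_pow_mul_two_pow]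
    push_cast; ring
  rw [← ENNReal.mul_le_mul_iff_left hne htop, hleft, hright, Nat.cast_le]

section Requests

/-- The weight of a request `(x, l)` for a program of length `l` that outputs `x`. -/
noncomputable def requestWeight (r : Option (List Bool × ℕ)) : ℝ≥0∞ :=
  r.elim 0 fun r => 2⁻¹ ^ r.2

theorem requestWeight_ne_top (r : Option (List Bool × ℕ)) : requestWeight r ≠ ∞ := by
  cases r <;> simp [requestWeight]

/-- The left end of the free part of the unit interval after serving `r`, if it was `s` before.
A pair `(m, a)` encodes the dyadic number `a / 2 ^ m`. A request for length `l` uses up an interval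
of length `2 * 2 ^ (-l)`, which contains a dyadic cell of length `2 ^ (-l)`. -/
def allocate (s : ℕ × ℕ) (r : Option (List Bool × ℕ)) : ℕ × ℕ :=
  r.casesOn s fun r => (s.1 + r.2, s.2 * 2 ^ r.2 + 2 * 2 ^ s.1)

/-- The left end of the free part of the unit interval when request `e` is served. -/
def allocated (req : ℕ → Option (List Bool × ℕ)) (e : ℕ) : ℕ × ℕ :=
  e.rec (0, 0) fun i s => allocate s (req i)

/-- The index of the first dyadic cell of length `2 ^ (-l)` to the right of `s`. -/
def codeword (s : ℕ × ℕ) (l : ℕ) : ℕ := s.2 * 2 ^ l / 2 ^ s.1 + 1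

/-- The string asked for in request `r` if program `p` is the codeword assigned to it when the left
end of the free part is `s`. -/
def serveAt (s : ℕ × ℕ) (p : List Bool) (r : List Bool × ℕ) : Option (List Bool) :=
  if p.length = r.2 ∧ msbVal p = codeword s p.length then some r.1 else none

/-- The output of program `p` if it is the codeword assigned to request `e`. -/
def serve (req : ℕ → Option (List Bool × ℕ)) (p : List Bool) (e : ℕ) : Option (List Bool) :=
  (req e).bind (serveAt (allocated req e) p)

/-- The machine that serves all requests. -/
def requestMachine (req : ℕ → Option (List Bool × ℕ)) : Machine :=
  fun p _ => Nat.rfindOpt (serve req p)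

/-- The real number encoded by `allocated req e`. -/
noncomputable def leftEnd (req : ℕ → Option (List Bool × ℕ)) (e : ℕ) : ℝ :=
  (allocated req e).2 / 2 ^ (allocated req e).1

variable {req : ℕ → Option (List Bool × ℕ)}

section Computability

open Primrec

theorem primrec_allocate : Primrec₂ allocate := by
  refine option_casesOn snd fst (pair ?_ ?_)
  · exact nat_add.comp (fst.comp (fst.comp fst)) (snd.comp snd)
  · exact nat_add.comp
      (nat_mul.comp (snd.comp (fst.comp fst)) (primrec_two_pow.comp (snd.comp snd)))
      (nat_mul.comp (const 2) (primrec_two_pow.comp (fst.comp (fst.comp fst))))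

theorem primrec_codeword : Primrec₂ codeword :=
  succ.comp (nat_div.comp (nat_mul.comp (snd.comp fst) (primrec_two_pow.comp snd))
    (primrec_two_pow.comp (fst.comp fst)))

theorem primrec_serveAt :
    Primrec fun q : ((ℕ × ℕ) × List Bool) × (List Bool × ℕ) => serveAt q.1.1 q.1.2 q.2 := by
  refine Primrec.ite (.and ?_ ?_) (option_some.comp (fst.comp snd)) (const none)
  · exact Primrec.eq.comp (list_length.comp (snd.comp fst)) (snd.comp snd)
  · exact Primrec.eq.comp (primrec_msbVal.comp (snd.comp fst))
      (primrec_codeword.comp (fst.comp fst) (list_length.comp (snd.comp fst)))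

theorem computable_allocated (hreq : Computable req) : Computable (allocated req) :=
  Computable.nat_rec .id (.const (0, 0)) (primrec_allocate.to_comp.comp
    (Computable.snd.comp .snd) (hreq.comp (Computable.fst.comp .snd))).to₂

theorem computable_serve (hreq : Computable req) : Computable₂ (serve req) :=
  Computable.option_bind (hreq.comp .snd) (primrec_serveAt.to_comp.comp (Computable.pair
    (Computable.pair ((computable_allocated hreq).comp (Computable.snd.comp .fst))
      (Computable.fst.comp .fst)) .snd)).to₂

theorem partrec_requestMachine (hreq : Computable req) : Partrec₂ (requestMachine req) :=
  Partrec.rfindOpt (f := fun q : List Bool × List Bool => serve req q.1)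
    ((computable_serve hreq).comp (Computable.fst.comp .fst) .snd).to₂

end Computability

theorem serve_eq_some_iff {p x : List Bool} {e : ℕ} :
    serve req p e = some x ↔
      req e = some (x, p.length) ∧ msbVal p = codeword (allocated req e) p.length := by
  rw [serve, Option.bind_eq_some_iff]
  constructor
  · rintro ⟨⟨z, l⟩, hr, hz⟩
    obtain ⟨⟨rfl, hval⟩, rfl⟩ : (p.length = l ∧ _) ∧ z = x := by simpa [serveAt] using hz
    exact ⟨hr, hval⟩
  · rintro ⟨hr, hval⟩
    exact ⟨_, hr, if_pos ⟨rfl, hval⟩⟩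

theorem leftEnd_succ (req : ℕ → Option (List Bool × ℕ)) (e : ℕ) :
    leftEnd req (e + 1) = leftEnd req e + 2 * (requestWeight (req e)).toReal := by
  have hsucc : allocated req (e + 1) = allocate (allocated req e) (req e) := rfl
  rw [leftEnd, leftEnd, hsucc]
  rcases req e with _ | ⟨x, l⟩
  · simp [allocate, requestWeight]
  · simp only [allocate, requestWeight, Option.elim_some, ENNReal.toReal_pow, ENNReal.toReal_inv,
      ENNReal.toReal_ofNat, pow_add, inv_pow]
    push_cast
    field_simp

theorem leftEnd_mono (req : ℕ → Option (List Bool × ℕ)) : Monotone (leftEnd req) :=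
  monotone_nat_of_le_succ fun e => by
    rw [leftEnd_succ]
    exact le_add_of_nonneg_right (by positivity)

theorem leftEnd_eq_sum (req : ℕ → Option (List Bool × ℕ)) (e : ℕ) :
    leftEnd req e = (2 * ∑ i ∈ Finset.range e, requestWeight (req i)).toReal := by
  rw [ENNReal.toReal_mul, ENNReal.toReal_ofNat,
    ENNReal.toReal_sum fun _ _ => requestWeight_ne_top _]
  induction e with
  | zero => simp [leftEnd, allocated]
  | succ e ih => rw [leftEnd_succ, ih, Finset.sum_range_succ, mul_add]

theorem leftEnd_le_one (hw : 2 * ∑' e, requestWeight (req e) ≤ 1) (e : ℕ) :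
    leftEnd req e ≤ 1 := by
  rw [leftEnd_eq_sum, ← ENNReal.toReal_one]
  exact ENNReal.toReal_mono ENNReal.one_ne_top
    ((mul_le_mul_right (ENNReal.sum_le_tsum _) 2).trans hw)

theorem codeword_bounds {e l : ℕ} {x : List Bool} (h : req e = some (x, l)) :
    leftEnd req e ≤ codeword (allocated req e) l / 2 ^ l ∧
      ((codeword (allocated req e) l : ℝ) + 1) / 2 ^ l ≤ leftEnd req (e + 1) := by
  have hscaled : leftEnd req e * 2 ^ l =
      (((allocated req e).2 * 2 ^ l : ℕ) : ℝ) / ((2 ^ (allocated req e).1 : ℕ)) := by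
    rw [leftEnd]; push_cast; ring
  have hcode : (codeword (allocated req e) l : ℝ) = ⌊leftEnd req e * 2 ^ l⌋₊ + 1 := by
    rw [hscaled, Nat.floor_div_eq_div, codeword, Nat.cast_succ]
  have hsucc : leftEnd req (e + 1) = leftEnd req e + 2 / 2 ^ l := by
    rw [leftEnd_succ, h]
    simp [requestWeight, div_eq_mul_inv]
  have hpos : (0 : ℝ) < 2 ^ l := by positivity
  have hnonneg : 0 ≤ leftEnd req e := by unfold leftEnd; positivity
  rw [hsucc, hcode, le_div_iff₀ hpos, div_le_iff₀ hpos, add_mul, div_mul_cancel₀ _ hpos.ne']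
  have := Nat.lt_floor_add_one (leftEnd req e * 2 ^ l)
  have := Nat.floor_le (mul_nonneg hnonneg hpos.le)
  constructor <;> linarith

theorem dyadicCell_subset_of_serve {p x : List Bool} {e : ℕ} (h : serve req p e = some x) :
    dyadicCell p ⊆ Set.Ico (leftEnd req e) (leftEnd req (e + 1)) := by
  obtain ⟨hreq, hval⟩ := serve_eq_some_iff.1 h
  obtain ⟨hleft, hright⟩ := codeword_bounds hreq
  rw [← hval] at hleft hright
  exact Set.Ico_subset_Ico hleft hright

theorem index_eq_of_prefix {p q x z : List Bool} {d e : ℕ} (hq : serve req q d = some x)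
    (hp : serve req p e = some z) (hqp : q <+: p) : d = e := by
  by_contra hne
  exact Set.disjoint_left.1 ((leftEnd_mono req).pairwise_disjoint_on_Ico_succ hne)
    (dyadicCell_subset_of_serve hq (dyadicCell_subset_of_prefix hqp (left_mem_dyadicCell p)))
    (dyadicCell_subset_of_serve hp (left_mem_dyadicCell p))

theorem prefixFree_requestMachine (req : ℕ → Option (List Bool × ℕ)) :
    PrefixFree (requestMachine req) := by
  intro y p q hp hq hqp
  obtain ⟨e, z, hz⟩ := Nat.rfindOpt_dom.1 hp
  obtain ⟨d, x, hx⟩ := Nat.rfindOpt_dom.1 hq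
  obtain rfl := index_eq_of_prefix hx hz hqp
  have hxz := (serve_eq_some_iff.1 hx).1.symm.trans (serve_eq_some_iff.1 hz).1
  exact hqp.eq_of_length (Prod.ext_iff.1 (Option.some.inj hxz)).2

theorem mem_requestMachine_of_serve {p x y : List Bool} {e : ℕ} (h : serve req p e = some x) :
    x ∈ requestMachine req p y := by
  obtain ⟨z, hz⟩ := Part.dom_iff_mem.1 (Nat.rfindOpt_dom.2 ⟨e, x, h⟩)
  obtain ⟨d, hd⟩ := Nat.rfindOpt_spec hz
  obtain rfl := index_eq_of_prefix hd h List.prefix_rfl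
  exact Option.some.inj (hd.symm.trans h) ▸ hz

theorem complexity_requestMachine_le (hw : 2 * ∑' e, requestWeight (req e) ≤ 1) {e l : ℕ}
    {x : List Bool} (h : req e = some (x, l)) (y : List Bool) :
    complexity (requestMachine req) x y ≤ l := by
  have hlt : codeword (allocated req e) l < 2 ^ l := by
    have hle := (codeword_bounds h).2.trans (leftEnd_le_one hw _)
    rw [div_le_one (by positivity)] at hle
    exact Nat.succ_le_iff.1 (by exact_mod_cast hle)
  obtain ⟨p, rfl, hval⟩ := exists_msbVal_eq hlt
  exact complexity_le_of_mem (mem_requestMachine_of_serve (serve_eq_some_iff.2 ⟨h, hval⟩))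

/-- The request `r`, for a program that is longer by `b`. -/
def delay (b : ℕ) (r : Option (List Bool × ℕ)) : Option (List Bool × ℕ) :=
  r.map fun r => (r.1, r.2 + b)

theorem primrec_delay (b : ℕ) : Primrec (delay b) :=
  Primrec.option_map .id (Primrec.pair (Primrec.fst.comp .snd)
    (Primrec.nat_add.comp (Primrec.snd.comp .snd) (.const b)))

theorem requestWeight_delay (b : ℕ) (r : Option (List Bool × ℕ)) :
    requestWeight (delay b r) = requestWeight r * 2⁻¹ ^ b := by
  rcases r with _ | r <;> simp [requestWeight, delay, pow_add]

theorem exists_nat_requests {ι : Type*} [Primcodable ι] {req : ι → Option (List Bool × ℕ)}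
    (hreq : Computable req) (hw : ∑' i, requestWeight (req i) ≠ ∞) :
    ∃ (b : ℕ) (req' : ℕ → Option (List Bool × ℕ)), Computable req' ∧
      2 * ∑' e, requestWeight (req' e) ≤ 1 ∧
      ∀ i x l, req i = some (x, l) → ∃ e, req' e = some (x, l + b) := by
  obtain ⟨b, hb⟩ : ∃ b : ℕ, 2 * ∑' i, requestWeight (req i) ≤ 2 ^ b := by
    obtain ⟨b, hb⟩ := ENNReal.exists_nat_gt (ENNReal.mul_ne_top (ENNReal.ofNat_ne_top (n := 2)) hw)
    exact ⟨b, hb.le.trans (by exact_mod_cast Nat.lt_two_pow_self.le)⟩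
  let req' (e : ℕ) := delay b ((Encodable.decode₂ ι e).bind req)
  have hencode (i : ι) : req' (Encodable.encode i) = delay b (req i) := by simp [req']
  refine ⟨b, req', ?_, ?_, fun i x l h => ⟨_, (hencode i).trans (by simp [h, delay])⟩⟩
  · exact (primrec_delay b).to_comp.comp
      (Computable.option_bind Primrec.decode₂.to_comp (hreq.comp .snd).to₂)
  · have hsupport : Function.support (fun e => requestWeight (req' e)) ⊆
        Set.range (Encodable.encode : ι → ℕ) := fun e he => by
      rcases hd : Encodable.decode₂ ι e with _ | i
      · simp [req', hd, requestWeight, delay] at he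
      · exact ⟨i, Encodable.decode₂_eq_some.1 hd⟩
    rw [← Encodable.encode_injective.tsum_eq hsupport]
    simp only [hencode, requestWeight_delay, ENNReal.tsum_mul_right]
    rw [← mul_assoc, mul_comm, ← inv_two_pow_mul_two_pow b]
    gcongr

/-- The Kraft–Chaitin theorem. -/
theorem IsPrefixOptimal.exists_complexity_le {V : Machine} (hV : IsPrefixOptimal V) {ι : Type*}
    [Primcodable ι] {req : ι → Option (List Bool × ℕ)} (hreq : Computable req)
    (hw : ∑' i, requestWeight (req i) ≠ ∞) :
    ∃ c : ℕ, ∀ i x l y, req i = some (x, l) → complexity V x y ≤ (l + c : ℕ) := by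
  obtain ⟨b, req', hcomp, hweight, hserved⟩ := exists_nat_requests hreq hw
  obtain ⟨c, hc⟩ := hV.2.2 _ (partrec_requestMachine hcomp) (prefixFree_requestMachine _)
  refine ⟨b + c, fun i x l y h => (hc x y).trans ?_⟩
  obtain ⟨e, he⟩ := hserved i x l h
  rw [← add_assoc, Nat.cast_add]
  gcongr
  exact complexity_requestMachine_le hweight he y

theorem IsPrefixOptimal.exists_complexity_eq {V : Machine} (hV : IsPrefixOptimal V)
    (x y : List Bool) : ∃ k : ℕ, complexity V x y = k := by
  obtain ⟨c, hc⟩ := hV.exists_complexity_le (ι := Unit) (req := fun _ => some (x, 0))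
    (.const _) (by simp [requestWeight])
  exact ⟨_, (ENat.natCast_toNat ((hc () x 0 y rfl).trans_lt (ENat.natCast_lt_top _)).ne).symm⟩

end Requests

/-! ### The game -/

/-- The parameters of a game: it is played on the strings of length `length`, under the assumption
that their programs have total weight at least `2 ^ (-deficit)`, and it ensures what the theorem
claims if requests for prefix-free programs are served up to the additive constant `slack`. -/
structure Params where
  slack : ℕ
  length : ℕ
  deficit : ℕ

namespace Params

/-- Games are indexed by triples of numbers, so that the requests of all of them can be issued
by one computable function. -/
def equivTriple : Params ≃ ℕ × ℕ × ℕ where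
  toFun g := (g.slack, g.length, g.deficit)
  invFun q := ⟨q.1, q.2.1, q.2.2⟩

instance : Primcodable Params := Primcodable.ofEquiv _ equivTriple

/-- The width of the ranges, and the distance between those of consecutive stages: it makes
requests that are served up to the constant `slack` keep complexities below the end of the range. -/
def gap (g : Params) : ℕ := 2 * g.slack + 5

/-- The binary logarithm of the number of stages. -/
def logStages (g : Params) : ℕ := Nat.log 2 g.length - g.gap

/-- The binary logarithm of the number of strings in play at stage `i`. The stages are numbered from
`1`; truncated subtraction gives stage `0`, before the launch, the same number of strings as
stage `1`. -/
def logSize (g : Params) (i : ℕ) : ℕ := g.length - (i - 1) * g.gap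

/-- The lower end of the range of complexities that belongs to stage `i`. The constant `3` makes
every cheap stage so costly that at most half of the stages can be cheap. -/
def lower (g : Params) (i : ℕ) : ℕ := g.deficit + g.logStages + g.logSize i - 3

/-- The range of complexities that belongs to stage `i`. -/
def range (g : Params) (i : ℕ) : Set ℕ := Set.Ico (g.lower i) (g.lower i + g.gap)

/-- The length of the programs that are requested for the strings in play at stage `i`, such that
the requests of all stages together have weight at most `2 ^ (-(deficit + slack + 1))`. -/
def requestLength (g : Params) (i : ℕ) : ℕ :=
  g.deficit + g.slack + 1 + g.logStages + g.logSize i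

end Params

section Game

variable {U V : Machine} (A : Approximation V) (B : Approximation U)

/-- By time `t`, a program for `x` shorter than `b` is found. -/
def IsLow (t b : ℕ) (x : List Bool) : Prop :=
  ∃ p ∈ shortStrings b, A.run t p [] = some x

/-- By time `t`, a program shorter than `logStages - 1` is found that, given `x`, outputs a number
in the range of stage `i`. -/
def IsHit (g : Params) (t i : ℕ) (x : List Bool) : Prop :=
  ∃ q ∈ shortStrings (g.logStages - 1), ∃ z ∈ (B.run t q x).toList, lsbVal z ∈ g.range i

/-- The programs for strings of length `n` that are found by time `t`. -/
def foundPrograms (t n : ℕ) : List (List Bool) :=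
  (shortStrings (t + 1)).filter fun p => (A.run t p []).map List.length = some n

/-- The total weight of the programs for strings of length `n` that are found by time `t`. -/
noncomputable def foundWeight (t n : ℕ) : ℝ≥0∞ :=
  ((foundPrograms A t n).map fun p => 2⁻¹ ^ p.length).sum

/-- Stage `i`, with the strings `S` in play, is over by time `t`: all strings in play have left the
range of the stage or have been hit in it. Stage `0` waits for the launch of the game. -/
def Settled (g : Params) (t i : ℕ) (S : List (List Bool)) : Prop :=
  (i = 0 ∧ 2⁻¹ ^ g.deficit ≤ foundWeight A t g.length) ∨
    (i ≠ 0 ∧ ∀ x ∈ S, IsLow A t (g.lower i) x ∨ IsHit B g t i x)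

open Classical in
/-- The strings kept in play after stage `i`, preferably those that have been hit. -/
noncomputable def nextStrings (g : Params) (t i : ℕ) (S : List (List Bool)) : List (List Bool) :=
  (S.filter (fun x => IsHit B g t i x) ++ S.filter fun x => ¬ IsHit B g t i x).take
    (2 ^ g.logSize (i + 1))

open Classical in
/-- One step of the game, at time `t`. -/
noncomputable def gameStep (g : Params) (t : ℕ) (st : ℕ × List (List Bool)) :
    ℕ × List (List Bool) :=
  if Settled A B g t st.1 st.2 then (st.1 + 1, nextStrings B g t st.1 st.2) else st

/-- The stage of the game and the strings in play at time `t`. -/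
noncomputable def gameState (g : Params) (t : ℕ) : ℕ × List (List Bool) :=
  t.rec (0, strings g.length) fun t st => gameStep A B g t st

/-- The stage of the game at time `t`. -/
noncomputable def stage (g : Params) (t : ℕ) : ℕ := (gameState A B g t).1

/-- The strings in play at time `t`. -/
noncomputable def inPlay (g : Params) (t : ℕ) : List (List Bool) := (gameState A B g t).2

/-- One of the stages `1, …, 2 ^ logStages` is entered at time `t`. -/
def Entered (g : Params) (t : ℕ) : Prop :=
  stage A B g t < stage A B g (t + 1) ∧ stage A B g (t + 1) ≤ 2 ^ g.logStages

open Classical in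
/-- The request issued for string `x` at time `t`: when a new stage is entered, a short program is
requested for each string in play. -/
noncomputable def gameRequest (q : Params × ℕ × List Bool) : Option (List Bool × ℕ) :=
  if Entered A B q.1 q.2.1 ∧ q.2.2 ∈ inPlay A B q.1 (q.2.1 + 1) then
    some (q.2.2, q.1.requestLength (stage A B q.1 (q.2.1 + 1)))
  else none

end Game

/-! ### Computability of the game -/

section Computability

open Primrec

namespace Params

theorem primrec_slack : Primrec slack := fst.comp (of_equiv (e := equivTriple))

theorem primrec_length : Primrec length := fst.comp (snd.comp (of_equiv (e := equivTriple)))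

theorem primrec_deficit : Primrec deficit := snd.comp (snd.comp (of_equiv (e := equivTriple)))

theorem primrec_gap : Primrec gap :=
  nat_add.comp (nat_mul.comp (const 2) primrec_slack) (const 5)

theorem primrec_logStages : Primrec logStages :=
  nat_sub.comp (primrec_log_two.comp primrec_length) primrec_gap

theorem primrec_logSize : Primrec₂ logSize :=
  nat_sub.comp (primrec_length.comp fst)
    (nat_mul.comp (nat_sub.comp snd (const 1)) (primrec_gap.comp fst))

theorem primrec_lower : Primrec₂ lower :=
  nat_sub.comp (nat_add.comp (nat_add.comp (primrec_deficit.comp fst)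
    (primrec_logStages.comp fst)) primrec_logSize) (const 3)

theorem primrec_requestLength : Primrec₂ requestLength :=
  nat_add.comp (nat_add.comp (nat_add.comp (nat_add.comp (primrec_deficit.comp fst)
    (primrec_slack.comp fst)) (const 1)) (primrec_logStages.comp fst)) primrec_logSize

end Params

variable {U V : Machine} (A : Approximation V) (B : Approximation U)
  {α : Type*} [Primcodable α] {g : α → Params} {t i : α → ℕ} {x : α → List Bool}
  {S : α → List (List Bool)}

theorem primrec_run {p : α → List Bool} (ht : Primrec t) (hp : Primrec p) (hx : Primrec x) :
    Primrec fun a => A.run (t a) (p a) (x a) :=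
  A.primrec_run.comp (ht.pair (hp.pair hx))

theorem primrecPred_isLow (ht : Primrec t) (hi : Primrec i) (hx : Primrec x) :
    PrimrecPred fun a => IsLow A (t a) (i a) (x a) :=
  primrecPred_exists_mem (primrec_shortStrings.comp hi) (Primrec.eq.comp
    (primrec_run A (ht.comp fst) snd (const [])) (option_some.comp (hx.comp fst))).primrecRel

theorem primrecPred_isHit (hg : Primrec g) (ht : Primrec t) (hi : Primrec i) (hx : Primrec x) :
    PrimrecPred fun a => IsHit B (g a) (t a) (i a) (x a) := by
  have hlower : Primrec fun q : (α × List Bool) × List Bool => (g q.1.1).lower (i q.1.1) :=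
    (Params.primrec_lower.comp hg hi).comp (fst.comp fst)
  have hgap : Primrec fun q : (α × List Bool) × List Bool => (g q.1.1).gap :=
    (Params.primrec_gap.comp hg).comp (fst.comp fst)
  have hval : Primrec fun q : (α × List Bool) × List Bool => lsbVal q.2 := primrec_lsbVal.comp snd
  have hrange : PrimrecRel fun (q : α × List Bool) (z : List Bool) =>
      lsbVal z ∈ (g q.1).range (i q.1) :=
    (PrimrecPred.and (nat_le.comp hlower hval)
      (nat_lt.comp hval (nat_add.comp hlower hgap))).primrecRel
  exact primrecPred_exists_mem
    (primrec_shortStrings.comp (nat_sub.comp (Params.primrec_logStages.comp hg) (const 1)))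
    (primrecPred_exists_mem
      (optionToList.comp (primrec_run B (ht.comp fst) snd (hx.comp fst))) hrange).primrecRel

theorem primrec_foundPrograms : Primrec₂ (foundPrograms A) := by
  have h : PrimrecRel fun (q : ℕ × ℕ) (p : List Bool) =>
      (A.run q.1 p []).map List.length = some q.2 :=
    (Primrec.eq.comp (option_map (primrec_run A (fst.comp fst) snd (const []))
      (list_length.comp snd).to₂) (option_some.comp (snd.comp fst))).primrecRel
  exact primrec_filter (primrec_shortStrings.comp (succ.comp fst)) h

theorem foundWeight_eq (t n : ℕ) :
    foundWeight A t n =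
      (((foundPrograms A t n).map fun p => 2 ^ (t - p.length)).sum : ℕ) * 2⁻¹ ^ t := by
  have hle : ∀ p ∈ foundPrograms A t n, p.length ≤ t := fun p hp =>
    Nat.lt_succ_iff.1 (mem_shortStrings.1 (List.mem_of_mem_filter hp))
  have hterm : ∀ p ∈ foundPrograms A t n,
      (2⁻¹ : ℝ≥0∞) ^ p.length = (2 ^ (t - p.length) : ℕ) * 2⁻¹ ^ t := fun p hp => by
    rw [← one_mul (2⁻¹ ^ p.length), ← inv_two_pow_mul_two_pow (t - p.length), mul_right_comm,
      ← pow_add, Nat.sub_add_cancel (hle p hp), mul_comm]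
    push_cast
    rfl
  rw [foundWeight, List.map_congr_left hterm, List.sum_map_mul_right, Nat.cast_list_sum,
    List.map_map]
  rfl

theorem primrecPred_settled (hg : Primrec g) (ht : Primrec t) (hi : Primrec i) (hS : Primrec S) :
    PrimrecPred fun a => Settled A B (g a) (t a) (i a) (S a) := by
  have hsum : Primrec fun a =>
      ((foundPrograms A (t a) (g a).length).map fun p => 2 ^ (t a - p.length)).sum :=
    primrec_sum.comp (list_map ((primrec_foundPrograms A).comp ht (Params.primrec_length.comp hg))
      (primrec_two_pow.comp (nat_sub.comp (ht.comp fst) (list_length.comp snd))).to₂)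
  have hlaunch : PrimrecPred fun a =>
      2⁻¹ ^ (g a).deficit ≤ foundWeight A (t a) (g a).length := by
    refine (nat_le.comp (primrec_two_pow.comp ht) (nat_mul.comp hsum
      (primrec_two_pow.comp (Params.primrec_deficit.comp hg)))).of_eq fun a => ?_
    rw [foundWeight_eq, ← one_mul (2⁻¹ ^ (g a).deficit), ← Nat.cast_one,
      natCast_mul_inv_two_pow_le_iff, one_mul]
  have hzero : PrimrecPred fun a => i a = 0 := Primrec.eq.comp hi (const 0)
  have hdone : PrimrecRel fun (a : α) (x : List Bool) =>
      IsLow A (t a) ((g a).lower (i a)) x ∨ IsHit B (g a) (t a) (i a) x :=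
    ((primrecPred_isLow A (ht.comp fst) ((Params.primrec_lower.comp hg hi).comp fst) snd).or
      (primrecPred_isHit B (hg.comp fst) (ht.comp fst) (hi.comp fst) snd)).primrecRel
  exact (hzero.and hlaunch).or (hzero.not.and (primrecPred_forall_mem hS hdone))

theorem primrec_nextStrings (hg : Primrec g) (ht : Primrec t) (hi : Primrec i) (hS : Primrec S) :
    Primrec fun a => nextStrings B (g a) (t a) (i a) (S a) := by
  classical
  have hhit : PrimrecRel fun (a : α) (x : List Bool) => IsHit B (g a) (t a) (i a) x :=
    (primrecPred_isHit B (hg.comp fst) (ht.comp fst) (hi.comp fst) snd).primrecRel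
  exact list_take.comp
    (primrec_two_pow.comp (Params.primrec_logSize.comp hg (succ.comp hi)))
    (list_append.comp (primrec_filter hS hhit) (primrec_filter hS hhit.not))

theorem primrec_gameStep (hg : Primrec g) (ht : Primrec t) {st : α → ℕ × List (List Bool)}
    (hst : Primrec st) : Primrec fun a => gameStep A B (g a) (t a) (st a) := by
  classical
  exact Primrec.ite (primrecPred_settled A B hg ht (fst.comp hst) (snd.comp hst))
    ((succ.comp (fst.comp hst)).pair (primrec_nextStrings B hg ht (fst.comp hst) (snd.comp hst)))
    hst

theorem primrec_gameState : Primrec₂ (gameState A B) :=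
  nat_rec ((const 0).pair (primrec_strings.comp Params.primrec_length))
    (primrec_gameStep A B fst (fst.comp snd) (snd.comp snd)).to₂

theorem primrec_gameRequest : Primrec (gameRequest A B) := by
  classical
  have hnow : Primrec fun q : Params × ℕ × List Bool => gameState A B q.1 q.2.1 :=
    (primrec_gameState A B).comp fst (fst.comp snd)
  have hnext : Primrec fun q : Params × ℕ × List Bool => gameState A B q.1 (q.2.1 + 1) :=
    (primrec_gameState A B).comp fst (succ.comp (fst.comp snd))
  have hentered : PrimrecPred fun q : Params × ℕ × List Bool => Entered A B q.1 q.2.1 :=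
    (nat_lt.comp (fst.comp hnow) (fst.comp hnext)).and
      (nat_le.comp (fst.comp hnext) (primrec_two_pow.comp (Params.primrec_logStages.comp fst)))
  have hmem : PrimrecPred fun q : Params × ℕ × List Bool =>
      q.2.2 ∈ inPlay A B q.1 (q.2.1 + 1) :=
    (primrecPred_exists_mem (snd.comp hnext)
      (Primrec.eq.comp (snd.comp (snd.comp fst)) snd).primrecRel).of_eq fun q => by simp [inPlay]
  exact Primrec.ite (hentered.and hmem) (option_some.comp ((snd.comp snd).pair
    (Params.primrec_requestLength.comp fst (fst.comp hnext)))) (const none)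

end Computability

/-! ### Kraft's inequality -/

theorem uniquelyDecodable_of_isAntichain {α : Type*} {S : Set (List α)}
    (hS : IsAntichain (· <+: ·) S) (hnil : [] ∉ S) : InformationTheory.UniquelyDecodable S := by
  intro L
  induction L with
  | nil =>
    rintro (_ | ⟨w, M⟩) - hM h
    · rfl
    · obtain rfl : w = [] := (List.append_eq_nil_iff.1 h.symm).1
      exact absurd (hM [] List.mem_cons_self) hnil
  | cons v L ih =>
    rintro (_ | ⟨w, M⟩) hL hM h
    · obtain rfl : v = [] := (List.append_eq_nil_iff.1 h).1
      exact absurd (hL [] List.mem_cons_self) hnil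
    · rw [List.forall_mem_cons] at hL hM
      rw [List.flatten_cons, List.flatten_cons] at h
      obtain rfl : v = w := (List.prefix_or_prefix_of_prefix (List.prefix_append v L.flatten)
        (h ▸ List.prefix_append w M.flatten)).elim (hS.eq hL.1 hM.1) (hS.eq' hL.1 hM.1)
      rw [ih M hL.2 hM.2 (List.append_cancel_left h)]

/-- The weight `∑ 2 ^ (-|p|)` of a set of programs `p`. -/
noncomputable def codeWeight (S : Set (List Bool)) : ℝ≥0∞ := ∑' p : S, 2⁻¹ ^ p.1.length

theorem sum_inv_two_pow_length_le_one {F : Finset (List Bool)}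
    (hF : IsAntichain (· <+: ·) (F : Set (List Bool))) :
    ∑ p ∈ F, (2⁻¹ : ℝ≥0∞) ^ p.length ≤ 1 := by
  by_cases hnil : [] ∈ F
  · have hsingle : F = {[]} := Finset.eq_singleton_iff_unique_mem.2
      ⟨hnil, fun p hp => (hF.eq hnil hp List.nil_prefix).symm⟩
    simp [hsingle]
  · have hfin : ∑ p ∈ F, (2⁻¹ : ℝ≥0∞) ^ p.length ≠ ∞ :=
      ENNReal.sum_ne_top.2 fun p _ => by finiteness
    rw [← ENNReal.toReal_le_toReal hfin ENNReal.one_ne_top]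
    simpa [ENNReal.toReal_sum] using InformationTheory.kraft_mcmillan_inequality
      (uniquelyDecodable_of_isAntichain hF (by exact_mod_cast hnil))

theorem codeWeight_eq_iSup (S : Set (List Bool)) :
    codeWeight S =
      ⨆ (F : Finset (List Bool)) (_ : (F : Set (List Bool)) ⊆ S), ∑ p ∈ F, 2⁻¹ ^ p.length := by
  refine le_antisymm ?_ (iSup₂_le fun F hF => ?_)
  · rw [codeWeight, ENNReal.tsum_eq_iSup_sum]
    refine iSup_le fun F => le_iSup₂_of_le (F.map (.subtype _)) (fun p hp => ?_)
      (Finset.sum_map F (.subtype _) fun p => (2⁻¹ : ℝ≥0∞) ^ p.length).ge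
    obtain ⟨q, -, rfl⟩ := Finset.mem_map.1 hp
    exact q.2
  · rw [← Finset.tsum_subtype']
    exact ENNReal.tsum_mono_subtype (fun p : List Bool => (2⁻¹ : ℝ≥0∞) ^ p.length) hF

theorem codeWeight_le_one {S : Set (List Bool)} (hS : IsAntichain (· <+: ·) S) :
    codeWeight S ≤ 1 := by
  rw [codeWeight_eq_iSup]
  exact iSup₂_le fun F hF => sum_inv_two_pow_length_le_one (hS.subset hF)

theorem codeWeight_iUnion {ι : Type*} {S : ι → Set (List Bool)}
    (hS : Set.univ.PairwiseDisjoint S) : codeWeight (⋃ i, S i) = ∑' i, codeWeight (S i) :=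
  ENNReal.tsum_biUnion (f := fun p : List Bool => 2⁻¹ ^ p.length) hS

/-- The weight of the programs for strings of length `n`. -/
noncomputable def programWeight (V : Machine) (n : ℕ) : ℝ≥0∞ :=
  codeWeight {p | ∃ x ∈ V p [], x.length = n}

theorem tsum_programWeight_le_one {V : Machine} (hV : PrefixFree V) :
    ∑' n, programWeight V n ≤ 1 := by
  have hdisj : Set.univ.PairwiseDisjoint fun n => {p | ∃ x ∈ V p [], x.length = n} :=
    fun m _ n _ hmn => Set.disjoint_left.2 fun p ⟨x, hx, hm⟩ ⟨z, hz, hn⟩ =>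
      hmn (hm ▸ hn ▸ congrArg List.length (Part.mem_unique hx hz))
  refine (codeWeight_iUnion hdisj).symm.trans_le
    (codeWeight_le_one fun p hp q hq hne hpq => ?_)
  simp only [Set.mem_iUnion] at hp hq
  obtain ⟨-, x, hx, -⟩ := hp
  obtain ⟨-, z, hz, -⟩ := hq
  exact hne (hV [] q p (Part.dom_iff_mem.2 ⟨z, hz⟩) (Part.dom_iff_mem.2 ⟨x, hx⟩) hpq)

theorem sum_inv_two_pow_complexity_le {V : Machine} {K : List Bool → ℕ}
    (hK : ∀ x, complexity V x [] = K x) (n : ℕ) :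
    ∑ x ∈ (strings n).toFinset, (2⁻¹ : ℝ≥0∞) ^ K x ≤ programWeight V n := by
  have hshortest (x : List Bool) : ∃ p, x ∈ V p [] ∧ p.length ≤ K x :=
    complexity_le_natCast_iff.1 (hK x).le
  choose p hp hlen using hshortest
  have hp_inj : Function.Injective p := fun x y h => Part.mem_unique (hp x) (h ▸ hp y)
  let shortest (x : (strings n).toFinset) : {p | ∃ x ∈ V p [], x.length = n} :=
    ⟨p x, x, hp x, mem_strings.1 (List.mem_toFinset.1 x.2)⟩
  have hinj : Function.Injective shortest := fun x y h =>
    Subtype.ext (hp_inj (congrArg Subtype.val h))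
  calc ∑ x ∈ (strings n).toFinset, (2⁻¹ : ℝ≥0∞) ^ K x
      = ∑' x : (strings n).toFinset, 2⁻¹ ^ K x :=
        (Finset.tsum_subtype _ fun x => (2⁻¹ : ℝ≥0∞) ^ K x).symm
    _ ≤ ∑' x, 2⁻¹ ^ (shortest x).1.length := ENNReal.tsum_le_tsum fun x =>
        pow_le_pow_right_of_le_one' (ENNReal.inv_le_one.2 one_le_two) (hlen x)
    _ ≤ programWeight V n := ENNReal.tsum_comp_le_tsum_of_injective hinj _

theorem exists_inv_two_pow_lt_le {m : ℝ≥0∞} (h0 : m ≠ 0) (h1 : m ≤ 1) :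
    ∃ s : ℕ, 2⁻¹ ^ s < m ∧ m ≤ 2 * 2⁻¹ ^ s := by
  classical
  have hex := ENNReal.exists_inv_two_pow_lt h0
  refine ⟨Nat.find hex, Nat.find_spec hex, ?_⟩
  rcases hs : Nat.find hex with _ | s
  · exact h1.trans (by simp)
  · have hmin : m ≤ 2⁻¹ ^ s := not_lt.1 (Nat.find_min hex (hs ▸ s.lt_succ_self))
    rwa [pow_succ', ← mul_assoc, ENNReal.mul_inv_cancel two_ne_zero ENNReal.ofNat_ne_top, one_mul]

/-! ### The launch of a game -/

section Launch

variable {V : Machine} (A : Approximation V)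

/-- The game with parameters `g` is launched at some time: the programs for strings of length
`g.length` turn out to have the weight that is assumed. -/
def Launched (g : Params) : Prop := ∃ t, 2⁻¹ ^ g.deficit ≤ foundWeight A t g.length

theorem nodup_shortStrings (b : ℕ) : (shortStrings b).Nodup :=
  List.nodup_flatMap.2 ⟨fun n _ => nodup_strings n, List.nodup_range.imp fun hmn _ hp hq =>
    hmn ((mem_strings.1 hp).symm.trans (mem_strings.1 hq))⟩

theorem mem_foundPrograms {t n : ℕ} {p : List Bool} :
    p ∈ foundPrograms A t n ↔ p.length ≤ t ∧ ∃ x, A.run t p [] = some x ∧ x.length = n := by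
  simp [foundPrograms, mem_shortStrings]

theorem foundWeight_eq_sum (t n : ℕ) :
    foundWeight A t n = ∑ p ∈ (foundPrograms A t n).toFinset, 2⁻¹ ^ p.length :=
  (List.sum_toFinset _ ((nodup_shortStrings _).filter _)).symm

theorem foundWeight_le_programWeight (t n : ℕ) : foundWeight A t n ≤ programWeight V n := by
  rw [foundWeight_eq_sum, ← Finset.tsum_subtype']
  refine ENNReal.tsum_mono_subtype (fun p : List Bool => (2⁻¹ : ℝ≥0∞) ^ p.length) fun p hp => ?_
  obtain ⟨-, x, hx, hn⟩ := (mem_foundPrograms A).1 (List.mem_toFinset.1 hp)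
  exact ⟨x, A.mem_iff.2 ⟨t, hx⟩, hn⟩

theorem exists_lt_foundWeight {n : ℕ} {a : ℝ≥0∞} (h : a < programWeight V n) :
    ∃ t, a < foundWeight A t n := by
  simp only [programWeight, codeWeight_eq_iSup, lt_iSup_iff] at h
  obtain ⟨F, hFV, hF⟩ := h
  have hfound : ∀ p ∈ F, ∀ᶠ t in Filter.atTop, p ∈ foundPrograms A t n := fun p hp => by
    obtain ⟨x, hx, hn⟩ := hFV hp
    obtain ⟨s, hs⟩ := A.mem_iff.1 hx
    filter_upwards [Filter.eventually_ge_atTop s, Filter.eventually_ge_atTop p.length] with t hst hp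
    exact (mem_foundPrograms A).2 ⟨hp, x, A.mono hst hs, hn⟩
  obtain ⟨t, ht⟩ := ((Filter.eventually_all_finset F).2 hfound).exists
  refine ⟨t, hF.trans_le ?_⟩
  rw [foundWeight_eq_sum]
  exact Finset.sum_le_sum_of_subset fun p hp => List.mem_toFinset.2 (ht p hp)

theorem exists_launched (hV : PrefixFree V) {K : List Bool → ℕ}
    (hK : ∀ x, complexity V x [] = K x) (c n : ℕ) :
    ∃ s, Launched A ⟨c, n, s⟩ ∧ ∑ x ∈ (strings n).toFinset, (2⁻¹ : ℝ≥0∞) ^ K x ≤ 2 * 2⁻¹ ^ s := by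
  have hsum := sum_inv_two_pow_complexity_le hK n
  have hpos : programWeight V n ≠ 0 := fun h0 => by
    rw [h0, le_zero_iff, Finset.sum_eq_zero_iff] at hsum
    exact pow_ne_zero _ (ENNReal.inv_ne_zero.2 ENNReal.ofNat_ne_top)
      (hsum (List.replicate n true) (by simp [mem_strings]))
  obtain ⟨s, hlt, hle⟩ :=
    exists_inv_two_pow_lt_le hpos ((ENNReal.le_tsum n).trans (tsum_programWeight_le_one hV))
  obtain ⟨t, ht⟩ := exists_lt_foundWeight A hlt
  exact ⟨s, ⟨t, ht.le⟩, hsum.trans hle⟩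

end Launch

/-! ### The weight of all requests -/

section Weight

variable {U V : Machine} (A : Approximation V) (B : Approximation U)

theorem gameState_succ (g : Params) (t : ℕ) :
    gameState A B g (t + 1) = gameStep A B g t (gameState A B g t) := rfl

open Classical in
theorem stage_succ (g : Params) (t : ℕ) : stage A B g (t + 1) =
    stage A B g t + if Settled A B g t (stage A B g t) (inPlay A B g t) then 1 else 0 := by
  unfold stage inPlay
  rw [gameState_succ, gameStep]
  split_ifs <;> rfl

open Classical in
theorem inPlay_succ (g : Params) (t : ℕ) : inPlay A B g (t + 1) =
    if Settled A B g t (stage A B g t) (inPlay A B g t) then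
      nextStrings B g t (stage A B g t) (inPlay A B g t)
    else inPlay A B g t := by
  unfold stage inPlay
  rw [gameState_succ, gameStep]
  split_ifs <;> rfl

theorem Params.logSize_succ_le (g : Params) (i : ℕ) : g.logSize (i + 1) ≤ g.logSize i :=
  Nat.sub_le_sub_left (Nat.mul_le_mul_right _ (Nat.sub_le_sub_right i.le_succ 1)) _

open Classical in
theorem length_nextStrings {g : Params} {i : ℕ} {S : List (List Bool)}
    (hS : S.length = 2 ^ g.logSize i) (t : ℕ) :
    (nextStrings B g t i S).length = 2 ^ g.logSize (i + 1) := by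
  have hsplit := List.length_eq_length_filter_add (l := S) fun x => IsHit B g t i x
  have hle : 2 ^ g.logSize (i + 1) ≤ 2 ^ g.logSize i :=
    Nat.pow_le_pow_right two_pos (g.logSize_succ_le i)
  rw [nextStrings, List.length_take_of_le]
  simpa [← hsplit, hS] using hle

theorem length_inPlay (g : Params) (t : ℕ) :
    (inPlay A B g t).length = 2 ^ g.logSize (stage A B g t) := by
  induction t with
  | zero => simp [inPlay, stage, gameState, length_strings, Params.logSize]
  | succ t ih =>
    rw [inPlay_succ, stage_succ]
    split_ifs
    · exact length_nextStrings B ih t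
    · exact ih

theorem stage_eq_zero {g : Params} (h : ¬ Launched A g) (t : ℕ) : stage A B g t = 0 := by
  induction t with
  | zero => rfl
  | succ t ih =>
    have hwait : ¬ Settled A B g t 0 (inPlay A B g t) := by
      rintro (⟨-, ht⟩ | ⟨h0, -⟩)
      exacts [h ⟨t, ht⟩, h0 rfl]
    rw [stage_succ, ih, if_neg hwait]

open Classical in
theorem card_entered_le (g : Params) (T : ℕ) :
    ((Finset.range T).filter (Entered A B g)).card ≤ min (stage A B g T) (2 ^ g.logStages) := by
  induction T with
  | zero => simp
  | succ T ih =>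
    have hsucc := stage_succ A B g T
    rw [Finset.range_add_one, Finset.filter_insert]
    split_ifs with h
    · rw [Finset.card_insert_of_notMem (by simp)]
      grind [Entered]
    · grind

open Classical in
theorem tsum_requestWeight_time_le (g : Params) (t : ℕ) :
    ∑' x, requestWeight (gameRequest A B (g, t, x)) ≤
      if Entered A B g t then 2⁻¹ ^ (g.deficit + g.slack + 1 + g.logStages) else 0 := by
  split_ifs with h
  · set S := inPlay A B g (t + 1)
    set i := stage A B g (t + 1)
    have hweight (x : List Bool) : requestWeight (gameRequest A B (g, t, x)) =
        if x ∈ S.toFinset then 2⁻¹ ^ g.requestLength i else 0 := by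
      simp only [gameRequest, h, true_and, List.mem_toFinset]
      split_ifs <;> rfl
    have hcard : (S.toFinset.card : ℝ≥0∞) ≤ 2 ^ g.logSize i := by
      exact_mod_cast S.toFinset_card_le.trans ((length_inPlay A B g (t + 1)).le)
    calc ∑' x, requestWeight (gameRequest A B (g, t, x))
        = S.toFinset.card * 2⁻¹ ^ g.requestLength i := by
          rw [tsum_congr hweight, tsum_eq_sum (s := S.toFinset) (fun x hx => if_neg hx),
            Finset.sum_congr rfl (fun x hx => if_pos hx), Finset.sum_const, nsmul_eq_mul]
      _ ≤ 2 ^ g.logSize i * 2⁻¹ ^ g.requestLength i := by gcongr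
      _ = 2⁻¹ ^ (g.deficit + g.slack + 1 + g.logStages) := by
          rw [Params.requestLength, pow_add _ _ (g.logSize i), mul_comm, mul_assoc,
            inv_two_pow_mul_two_pow, mul_one]
  · simp [gameRequest, h, requestWeight]

open Classical in
theorem tsum_requestWeight_game_le (g : Params) :
    ∑' q : ℕ × List Bool, requestWeight (gameRequest A B (g, q)) ≤
      if Launched A g then 2⁻¹ ^ (g.deficit + g.slack + 1) else 0 := by
  rw [ENNReal.tsum_prod']
  refine (ENNReal.tsum_le_tsum (tsum_requestWeight_time_le A B g)).trans ?_
  rw [ENNReal.tsum_eq_iSup_nat]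
  refine iSup_le fun T => ?_
  rw [← Finset.sum_filter, Finset.sum_const, nsmul_eq_mul]
  have hcard := card_entered_le A B g T
  split_ifs with h
  · have hle : (((Finset.range T).filter (Entered A B g)).card : ℝ≥0∞) ≤ 2 ^ g.logStages := by
      exact_mod_cast hcard.trans (min_le_right _ _)
    refine (mul_le_mul_left hle _).trans_eq ?_
    rw [pow_add _ _ g.logStages, mul_comm, mul_assoc, inv_two_pow_mul_two_pow, mul_one]
  · rw [stage_eq_zero A B h] at hcard
    simp [Nat.le_zero.1 (hcard.trans (min_le_left _ _))]

theorem tsum_ite_inv_two_pow_le {P : ℕ → Prop} [DecidablePred P] {b : ℝ≥0∞}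
    (h : ∀ s, P s → 2⁻¹ ^ s ≤ b) : ∑' s, (if P s then 2⁻¹ ^ s else 0) ≤ 2 * b := by
  by_cases hP : ∃ s, P s
  · obtain ⟨m, hm, hmin⟩ : ∃ m, P m ∧ ∀ s < m, ¬ P s :=
      ⟨Nat.find hP, Nat.find_spec hP, fun _ => Nat.find_min hP⟩
    have hzero : ∀ s ∈ Finset.range m, (if P s then (2⁻¹ : ℝ≥0∞) ^ s else 0) = 0 :=
      fun s hs => if_neg (hmin s (Finset.mem_range.1 hs))
    have htail (i : ℕ) : (if P (i + m) then (2⁻¹ : ℝ≥0∞) ^ (i + m) else 0) ≤ 2⁻¹ ^ i * b := by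
      split_ifs
      · rw [pow_add]
        exact mul_le_mul_right (h m hm) _
      · exact zero_le
    rw [← Summable.sum_add_tsum_nat_add' (k := m) ENNReal.summable, Finset.sum_eq_zero hzero,
      zero_add]
    refine (ENNReal.tsum_le_tsum htail).trans_eq ?_
    rw [ENNReal.tsum_mul_right, ENNReal.tsum_geometric, ENNReal.one_sub_inv_two, inv_inv]
  · simp [not_exists.1 hP]

theorem tsum_requestWeight_slack_length_le (c n : ℕ) :
    ∑' s, ∑' q : ℕ × List Bool, requestWeight (gameRequest A B (⟨c, n, s⟩, q)) ≤
      2⁻¹ ^ (c + 1) * (2 * programWeight V n) := by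
  classical
  calc ∑' s, ∑' q : ℕ × List Bool, requestWeight (gameRequest A B (⟨c, n, s⟩, q))
      ≤ ∑' s, 2⁻¹ ^ (c + 1) * if Launched A ⟨c, n, s⟩ then 2⁻¹ ^ s else 0 := by
        refine ENNReal.tsum_le_tsum fun s => (tsum_requestWeight_game_le A B _).trans_eq ?_
        rw [mul_ite, mul_zero, add_assoc, pow_add, mul_comm]
    _ ≤ 2⁻¹ ^ (c + 1) * (2 * programWeight V n) := by
        rw [ENNReal.tsum_mul_left]
        gcongr
        exact tsum_ite_inv_two_pow_le fun s ⟨t, ht⟩ => ht.trans (foundWeight_le_programWeight A t n)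

theorem tsum_requestWeight_ne_top (hV : PrefixFree V) :
    ∑' q, requestWeight (gameRequest A B q) ≠ ∞ := by
  refine ne_top_of_le_ne_top ENNReal.ofNat_ne_top (b := 2) ?_
  calc ∑' q, requestWeight (gameRequest A B q)
      = ∑' c, ∑' n, ∑' s, ∑' q : ℕ × List Bool,
          requestWeight (gameRequest A B (⟨c, n, s⟩, q)) := by
        rw [ENNReal.tsum_prod', ← Params.equivTriple.symm.tsum_eq, ENNReal.tsum_prod']
        exact tsum_congr fun c => ENNReal.tsum_prod'
    _ ≤ ∑' c, ∑' n, 2⁻¹ ^ (c + 1) * (2 * programWeight V n) := by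
        gcongr
        exact tsum_requestWeight_slack_length_le A B _ _
    _ = 2 * ∑' n, programWeight V n := by
        simp only [ENNReal.tsum_mul_left, ENNReal.tsum_mul_right, ENNReal.tsum_geometric_add_one,
          ENNReal.one_sub_inv_two, inv_inv]
        rw [ENNReal.inv_mul_cancel two_ne_zero ENNReal.ofNat_ne_top, one_mul]
    _ ≤ 2 := mul_le_of_le_one_right' (tsum_programWeight_le_one hV)

end Weight

/-! ### Few stages are cheap, and few are guessed -/

namespace Params

/-- The strings of the game are long enough for all its stages. -/
def Large (g : Params) : Prop := 2 ^ (g.gap + 1) ≤ g.length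

theorem four_mul_gap_le (g : Params) : 4 * g.gap ≤ 2 ^ g.gap := by
  have hslack : g.slack < 4 ^ g.slack := Nat.lt_pow_self (by norm_num)
  calc 4 * g.gap ≤ 4 ^ g.slack * 32 := by unfold gap; omega
    _ = 2 ^ g.gap := by rw [gap, pow_add, pow_mul]; norm_num

variable {g : Params} {i j : ℕ}

theorem Large.length_ne_zero (hg : g.Large) : g.length ≠ 0 :=
  ((Nat.two_pow_pos _).trans_le hg).ne'

theorem Large.gap_lt_log (hg : g.Large) : g.gap < Nat.log 2 g.length :=
  (Nat.le_log_iff_pow_le one_lt_two hg.length_ne_zero).2 hg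

theorem Large.one_le_logStages (hg : g.Large) : 1 ≤ g.logStages :=
  Nat.sub_pos_of_lt hg.gap_lt_log

theorem Large.le_length (hg : g.Large) : 32 ≤ g.length :=
  (Nat.pow_le_pow_right two_pos (by unfold gap; omega : 5 ≤ g.gap + 1)).trans hg

theorem Large.four_mul_two_pow_mul_gap_le (hg : g.Large) :
    4 * (2 ^ g.logStages * g.gap) ≤ g.length :=
  calc 4 * (2 ^ g.logStages * g.gap) = 2 ^ g.logStages * (4 * g.gap) := by ring
    _ ≤ 2 ^ g.logStages * 2 ^ g.gap := Nat.mul_le_mul_left _ g.four_mul_gap_le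
    _ = 2 ^ Nat.log 2 g.length := by rw [← pow_add, logStages, Nat.sub_add_cancel hg.gap_lt_log.le]
    _ ≤ g.length := Nat.pow_log_le_self 2 hg.length_ne_zero

theorem Large.four_mul_sub_one_mul_gap_le (hg : g.Large) (hi : i ≤ 2 ^ g.logStages) :
    4 * ((i - 1) * g.gap) ≤ g.length :=
  (Nat.mul_le_mul_left _ (Nat.mul_le_mul_right _ ((i.sub_le 1).trans hi))).trans
    hg.four_mul_two_pow_mul_gap_le

theorem Large.three_mul_length_le (hg : g.Large) (hi : i ≤ 2 ^ g.logStages) :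
    3 * g.length ≤ 4 * g.logSize i := by
  have hoffset := hg.four_mul_sub_one_mul_gap_le hi
  unfold logSize
  omega

theorem Large.logSize_succ_lt (hg : g.Large) (h0 : i ≠ 0) (hi : i ≤ 2 ^ g.logStages) :
    g.logSize (i + 1) < g.logSize i := by
  have hlength := hg.le_length
  have hsize := hg.three_mul_length_le hi
  have hsucc : g.logSize (i + 1) = g.logSize i - g.gap := by
    rw [logSize, logSize, Nat.sub_sub, ← Nat.succ_mul, Nat.succ_eq_add_one, Nat.add_sub_cancel,
      Nat.sub_add_cancel (Nat.one_le_iff_ne_zero.2 h0)]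
  unfold gap at hsucc
  omega

theorem Large.lower_add_three (hg : g.Large) (hi : i ≤ 2 ^ g.logStages) :
    g.lower i + 3 = g.deficit + g.logStages + g.logSize i := by
  have hlength := hg.le_length
  have hsize := hg.three_mul_length_le hi
  unfold lower
  omega

theorem Large.length_le_two_mul_lower (hg : g.Large) (hi : i ≤ 2 ^ g.logStages) :
    g.length ≤ 2 * g.lower i := by
  have hlength := hg.le_length
  have hsize := hg.three_mul_length_le hi
  have hlower := hg.lower_add_three hi
  omega

theorem Large.requestLength_add_slack_lt (hg : g.Large) (hi : i ≤ 2 ^ g.logStages) :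
    g.requestLength i + g.slack < g.lower i + g.gap := by
  have hlower := hg.lower_add_three hi
  unfold requestLength gap
  omega

theorem Large.lower_add_gap_le (hg : g.Large) (h0 : i ≠ 0) (hij : i < j)
    (hj : j ≤ 2 ^ g.logStages) : g.lower j + g.gap ≤ g.lower i := by
  have hlower_i := hg.lower_add_three (hij.le.trans hj)
  have hlower_j := hg.lower_add_three hj
  have hoffset_j := hg.four_mul_sub_one_mul_gap_le hj
  have hstep : (i - 1) * g.gap + g.gap ≤ (j - 1) * g.gap := by
    rw [← Nat.succ_mul]
    exact Nat.mul_le_mul_right _ (by omega)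
  unfold logSize at hlower_i hlower_j
  omega

theorem Large.pairwiseDisjoint_range (hg : g.Large) :
    (Set.Icc 1 (2 ^ g.logStages)).PairwiseDisjoint g.range := by
  have hlt {i j : ℕ} (hi : i ∈ Set.Icc 1 (2 ^ g.logStages)) (hj : j ∈ Set.Icc 1 (2 ^ g.logStages))
      (hij : i < j) : Disjoint (g.range i) (g.range j) :=
    Set.disjoint_left.2 fun k hk hk' => absurd hk.1 <| not_le.2 <|
      hk'.2.trans_le (hg.lower_add_gap_le (Nat.one_le_iff_ne_zero.1 hi.1) hij hj.2)
  intro i hi j hj hne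
  exact hne.lt_or_gt.elim (hlt hi hj) fun h => (hlt hj hi h).symm

theorem Large.injOn_lower (hg : g.Large) : Set.InjOn g.lower (Set.Icc 1 (2 ^ g.logStages)) := by
  have hmem (i : ℕ) : g.lower i ∈ g.range i := Set.left_mem_Ico.2 (by unfold gap; omega)
  exact fun i hi j hj h => hg.pairwiseDisjoint_range.elim hi hj <|
    Set.not_disjoint_iff.2 ⟨g.lower i, hmem i, h ▸ hmem j⟩

end Params

theorem sum_ite_lt_inv_two_pow_le {ι : Type*} {J : Finset ι} {b : ι → ℕ} (hb : Set.InjOn b J)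
    (k : ℕ) : ∑ i ∈ J, (if k < b i then (2⁻¹ : ℝ≥0∞) ^ b i else 0) ≤ 2⁻¹ ^ k := by
  classical
  calc ∑ i ∈ J, (if k < b i then (2⁻¹ : ℝ≥0∞) ^ b i else 0)
      = ∑ s ∈ J.image b, if k < s then (2⁻¹ : ℝ≥0∞) ^ s else 0 :=
        (Finset.sum_image (f := fun s => if k < s then (2⁻¹ : ℝ≥0∞) ^ s else 0) hb).symm
    _ ≤ ∑' s, if k < s then (2⁻¹ : ℝ≥0∞) ^ s else 0 := ENNReal.sum_le_tsum _
    _ ≤ 2 * 2⁻¹ ^ (k + 1) := tsum_ite_inv_two_pow_le fun s hs =>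
        pow_le_pow_right_of_le_one' (by simp) hs
    _ = 2⁻¹ ^ k := by
        rw [pow_succ', ← mul_assoc, ENNReal.mul_inv_cancel two_ne_zero ENNReal.ofNat_ne_top,
          one_mul]

theorem sum_card_mul_inv_two_pow_le {α ι : Type*} (F : Finset α) (K : α → ℕ) {J : Finset ι}
    {b : ι → ℕ} (hb : Set.InjOn b J) :
    ∑ i ∈ J, ((F.filter (K · < b i)).card : ℝ≥0∞) * 2⁻¹ ^ b i ≤ ∑ x ∈ F, (2⁻¹ : ℝ≥0∞) ^ K x :=
  calc ∑ i ∈ J, ((F.filter (K · < b i)).card : ℝ≥0∞) * 2⁻¹ ^ b i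
      = ∑ i ∈ J, ∑ x ∈ F, if K x < b i then (2⁻¹ : ℝ≥0∞) ^ b i else 0 :=
        Finset.sum_congr rfl fun i _ => by rw [← Finset.sum_filter, Finset.sum_const, nsmul_eq_mul]
    _ = ∑ x ∈ F, ∑ i ∈ J, if K x < b i then (2⁻¹ : ℝ≥0∞) ^ b i else 0 := Finset.sum_comm
    _ ≤ ∑ x ∈ F, (2⁻¹ : ℝ≥0∞) ^ K x := Finset.sum_le_sum fun x _ => sum_ite_lt_inv_two_pow_le hb _

/-- The strings with complexities below the range of stage `i` are at least half as many as the
strings in play at that stage. -/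
def IsCheap (K : List Bool → ℕ) (g : Params) (i : ℕ) : Prop :=
  2 ^ g.logSize i ≤ 2 * ((strings g.length).toFinset.filter (K · < g.lower i)).card

theorem two_mul_card_isCheap_le {g : Params} (hg : g.Large) {K : List Bool → ℕ}
    (hmass : ∑ x ∈ (strings g.length).toFinset, (2⁻¹ : ℝ≥0∞) ^ K x ≤ 2 * 2⁻¹ ^ g.deficit)
    {J : Finset ℕ} (hJ : (J : Set ℕ) ⊆ Set.Icc 1 (2 ^ g.logStages))
    (hcheap : ∀ i ∈ J, IsCheap K g i) :
    2 * J.card ≤ 2 ^ g.logStages := by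
  have hterm : ∀ i ∈ J, ((4 : ℕ) : ℝ≥0∞) * 2⁻¹ ^ (g.deficit + g.logStages) ≤
      ((strings g.length).toFinset.filter (K · < g.lower i)).card * 2⁻¹ ^ g.lower i := by
    intro i hi
    have hpow : 2 ^ g.lower i * 2 ^ 3 = 2 ^ (g.deficit + g.logStages) * 2 ^ g.logSize i := by
      rw [← pow_add, ← pow_add, hg.lower_add_three (hJ hi).2]
    have hmul := Nat.mul_le_mul_left (2 ^ (g.deficit + g.logStages)) (hcheap i hi)
    rw [natCast_mul_inv_two_pow_le_iff]
    linarith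
  have hsum : ((J.card * 4 : ℕ) : ℝ≥0∞) * 2⁻¹ ^ (g.deficit + g.logStages) ≤
      (2 : ℕ) * 2⁻¹ ^ g.deficit :=
    calc ((J.card * 4 : ℕ) : ℝ≥0∞) * 2⁻¹ ^ (g.deficit + g.logStages)
        = ∑ i ∈ J, ((4 : ℕ) : ℝ≥0∞) * 2⁻¹ ^ (g.deficit + g.logStages) := by
          rw [Finset.sum_const, nsmul_eq_mul, Nat.cast_mul, mul_assoc]
      _ ≤ ∑ i ∈ J, (((strings g.length).toFinset.filter (K · < g.lower i)).card : ℝ≥0∞) *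
            2⁻¹ ^ g.lower i := Finset.sum_le_sum hterm
      _ ≤ ∑ x ∈ (strings g.length).toFinset, 2⁻¹ ^ K x :=
          sum_card_mul_inv_two_pow_le _ K (hg.injOn_lower.mono hJ)
      _ ≤ (2 : ℕ) * 2⁻¹ ^ g.deficit := hmass
  rw [natCast_mul_inv_two_pow_le_iff, pow_add] at hsum
  refine Nat.le_of_mul_le_mul_left ?_ (Nat.mul_pos two_pos (g.deficit.two_pow_pos))
  linarith

/-- Some program shorter than `logStages - 1` outputs, given `x`, a number in the range of
stage `i`. -/
def IsGuessed (U : Machine) (g : Params) (i : ℕ) (x : List Bool) : Prop :=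
  ∃ q : List Bool, q.length < g.logStages - 1 ∧ ∃ z ∈ U q x, lsbVal z ∈ g.range i

theorem card_isGuessed_lt {U : Machine} {g : Params} (hg : g.Large) {x : List Bool} {J : Finset ℕ}
    (hJ : (J : Set ℕ) ⊆ Set.Icc 1 (2 ^ g.logStages)) (hguessed : ∀ i ∈ J, IsGuessed U g i x) :
    J.card < 2 ^ (g.logStages - 1) := by
  classical
  choose! q hq z hz hrange using hguessed
  have hq_inj : Set.InjOn q J := fun i hi j hj hij => by
    have hzz : z i = z j := Part.mem_unique (hz i hi) (hij ▸ hz j hj)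
    exact hg.pairwiseDisjoint_range.elim (hJ hi) (hJ hj) <|
      Set.not_disjoint_iff.2 ⟨lsbVal (z i), hrange i hi, hzz ▸ hrange j hj⟩
  rw [← Finset.card_image_of_injOn hq_inj]
  exact card_lt_two_pow (Finset.forall_mem_image.2 hq)

/-! ### The game gets stuck -/

section Play

variable {U V : Machine} (A : Approximation V) (B : Approximation U) {g : Params} {t i : ℕ}
  {x : List Bool} {S : List (List Bool)} {K : List Bool → ℕ}

theorem IsLow.complexity_lt (hK : ∀ x, complexity V x [] = K x) {b : ℕ} (h : IsLow A t b x) :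
    K x < b := by
  obtain ⟨p, hp, hx⟩ := h
  have hle := complexity_le_of_mem (A.mem_iff.2 ⟨t, hx⟩)
  rw [hK, Nat.cast_le] at hle
  exact hle.trans_lt (mem_shortStrings.1 hp)

theorem IsHit.isGuessed (h : IsHit B g t i x) : IsGuessed U g i x := by
  obtain ⟨q, hq, z, hz, hrange⟩ := h
  exact ⟨q, mem_shortStrings.1 hq, z, B.mem_iff.2 ⟨t, Option.mem_toList.1 hz⟩, hrange⟩

theorem eventually_isLow (hK : ∀ x, complexity V x [] = K x) {b : ℕ} (h : K x < b) :
    ∀ᶠ t in Filter.atTop, IsLow A t b x := by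
  obtain ⟨p, hp, hlen⟩ := complexity_le_natCast_iff.1 (hK x).le
  obtain ⟨s, hs⟩ := A.mem_iff.1 hp
  filter_upwards [Filter.eventually_ge_atTop s] with t ht
  exact ⟨p, mem_shortStrings.2 (hlen.trans_lt h), A.mono ht hs⟩

theorem eventually_isHit (h : IsGuessed U g i x) : ∀ᶠ t in Filter.atTop, IsHit B g t i x := by
  obtain ⟨q, hq, z, hz, hrange⟩ := h
  obtain ⟨s, hs⟩ := B.mem_iff.1 hz
  filter_upwards [Filter.eventually_ge_atTop s] with t ht
  exact ⟨q, mem_shortStrings.2 hq, z, Option.mem_toList.2 (B.mono ht hs), hrange⟩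

theorem eventually_settled (hK : ∀ x, complexity V x [] = K x) (h0 : i ≠ 0)
    (h : ∀ x ∈ S, K x < g.lower i ∨ IsGuessed U g i x) :
    ∀ᶠ t in Filter.atTop, Settled A B g t i S := by
  have hS : ∀ x ∈ S.toFinset, ∀ᶠ t in Filter.atTop, IsLow A t (g.lower i) x ∨ IsHit B g t i x :=
    fun x hx => (h x (List.mem_toFinset.1 hx)).elim
      (fun hlow => (eventually_isLow A hK hlow).mono fun _ => Or.inl)
      fun hguessed => (eventually_isHit B hguessed).mono fun _ => Or.inr
  filter_upwards [(Filter.eventually_all_finset _).2 hS] with t ht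
  exact Or.inr ⟨h0, fun x hx => ht x (List.mem_toFinset.2 hx)⟩

open Classical in
theorem filter_isHit_append_perm : (S.filter (fun x => IsHit B g t i x) ++
    S.filter fun x => ¬ IsHit B g t i x).Perm S := by
  simpa using List.filter_append_perm (fun x => decide (IsHit B g t i x)) S

theorem nodup_nextStrings (hS : S.Nodup) : (nextStrings B g t i S).Nodup :=
  ((filter_isHit_append_perm B).nodup_iff.2 hS).sublist (List.take_sublist _ _)

theorem nextStrings_subset : nextStrings B g t i S ⊆ S := fun _ hx =>
  (filter_isHit_append_perm B).mem_iff.1 (List.mem_of_mem_take hx)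

open Classical in
theorem isHit_of_mem_nextStrings
    (h : 2 ^ g.logSize (i + 1) ≤ (S.filter fun x => IsHit B g t i x).length)
    (hx : x ∈ nextStrings B g t i S) : IsHit B g t i x := by
  rw [nextStrings, List.take_append_of_le_length h] at hx
  simpa using List.of_mem_filter (List.mem_of_mem_take hx)

theorem isCheap_or_isGuessed_of_settled (hK : ∀ x, complexity V x [] = K x) (hg : g.Large)
    (h0 : i ≠ 0) (hi : i ≤ 2 ^ g.logStages) (hnodup : S.Nodup) (hlen : S.length = 2 ^ g.logSize i)
    (hmem : ∀ x ∈ S, x.length = g.length) (hsettled : Settled A B g t i S) :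
    IsCheap K g i ∨ ∀ x ∈ nextStrings B g t i S, IsGuessed U g i x := by
  classical
  rcases le_or_gt (2 ^ g.logSize (i + 1)) (S.filter fun x => IsHit B g t i x).length
    with hhit | hhit
  · exact Or.inr fun x hx => (isHit_of_mem_nextStrings B hhit hx).isGuessed B
  · left
    have hlow : (S.filter fun x => ¬ IsHit B g t i x).toFinset ⊆
        (strings g.length).toFinset.filter (K · < g.lower i) := fun x hx => by
      obtain ⟨hxS, hx⟩ := List.mem_filter.1 (List.mem_toFinset.1 hx)
      have hxlow := ((hsettled.resolve_left fun h => h0 h.1).2 x hxS).resolve_right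
        (of_decide_eq_true hx)
      exact Finset.mem_filter.2 ⟨List.mem_toFinset.2 (mem_strings.2 (hmem x hxS)),
        hxlow.complexity_lt A hK⟩
    have hcard := Finset.card_le_card hlow
    rw [List.toFinset_card_of_nodup (hnodup.filter _)] at hcard
    have hsplit := (filter_isHit_append_perm B (g := g) (t := t) (i := i) (S := S)).length_eq
    rw [List.length_append, hlen] at hsplit
    have hhalf : 2 * 2 ^ g.logSize (i + 1) ≤ 2 ^ g.logSize i := by
      rw [← pow_succ']
      exact Nat.pow_le_pow_right two_pos (hg.logSize_succ_lt h0 hi)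
    unfold IsCheap
    omega

theorem inPlay_succ_subset : inPlay A B g (t + 1) ⊆ inPlay A B g t := by
  rw [inPlay_succ]
  split_ifs
  exacts [nextStrings_subset B, List.Subset.refl _]

theorem nodup_inPlay (g : Params) (t : ℕ) : (inPlay A B g t).Nodup := by
  induction t with
  | zero => exact nodup_strings _
  | succ t ih =>
    rw [inPlay_succ]
    split_ifs
    exacts [nodup_nextStrings B ih, ih]

theorem length_of_mem_inPlay (hx : x ∈ inPlay A B g t) : x.length = g.length := by
  induction t with
  | zero => exact mem_strings.1 hx
  | succ t ih => exact ih (inPlay_succ_subset A B hx)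

theorem exists_gameRequest_eq (hx : x ∈ inPlay A B g t) (h0 : stage A B g t ≠ 0)
    (ht : stage A B g t ≤ 2 ^ g.logStages) :
    ∃ q, gameRequest A B q = some (x, g.requestLength (stage A B g t)) := by
  induction t with
  | zero => exact absurd rfl h0
  | succ t ih =>
    have hsucc := stage_succ A B g t
    by_cases hsettled : Settled A B g t (stage A B g t) (inPlay A B g t)
    · rw [if_pos hsettled] at hsucc
      exact ⟨(g, t, x), if_pos ⟨⟨hsucc ▸ Nat.lt_succ_self _, ht⟩, hx⟩⟩
    · rw [if_neg hsettled, add_zero] at hsucc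
      rw [hsucc] at h0 ht ⊢
      exact ih (inPlay_succ_subset A B hx) h0 ht

theorem isCheap_or_isGuessed_of_lt_stage (hK : ∀ x, complexity V x [] = K x) (hg : g.Large)
    (h0 : i ≠ 0) (hi : i ≤ 2 ^ g.logStages) (ht : i < stage A B g t) :
    IsCheap K g i ∨ ∀ x ∈ inPlay A B g t, IsGuessed U g i x := by
  induction t with
  | zero => exact absurd ht i.not_lt_zero
  | succ t ih =>
    rcases lt_or_ge i (stage A B g t) with hlt | hge
    · exact (ih hlt).imp_right fun h x hx => h x (inPlay_succ_subset A B hx)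
    · rw [stage_succ] at ht
      rw [inPlay_succ]
      split_ifs at ht ⊢ with hsettled
      · obtain rfl : stage A B g t = i := by omega
        exact isCheap_or_isGuessed_of_settled A B hK hg h0 hi (nodup_inPlay A B g t)
          (length_inPlay A B g t) (fun _ => length_of_mem_inPlay A B) hsettled
      · omega

theorem stage_le_two_pow (hK : ∀ x, complexity V x [] = K x) (hg : g.Large)
    (hmass : ∑ x ∈ (strings g.length).toFinset, (2⁻¹ : ℝ≥0∞) ^ K x ≤ 2 * 2⁻¹ ^ g.deficit) (t : ℕ) :
    stage A B g t ≤ 2 ^ g.logStages := by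
  classical
  by_contra! hlt
  obtain ⟨x, hx⟩ : ∃ x, x ∈ inPlay A B g t := List.exists_mem_of_length_pos <| by
    rw [length_inPlay]
    exact Nat.two_pow_pos _
  have hcheap : 2 * ((Finset.Icc 1 (2 ^ g.logStages)).filter (IsCheap K g)).card ≤
      2 ^ g.logStages :=
    two_mul_card_isCheap_le hg hmass (fun i hi => Finset.mem_Icc.1 (Finset.mem_filter.1 hi).1)
      fun i hi => (Finset.mem_filter.1 hi).2
  have hguessed : ((Finset.Icc 1 (2 ^ g.logStages)).filter fun i => ¬ IsCheap K g i).card <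
      2 ^ (g.logStages - 1) := by
    refine card_isGuessed_lt hg (U := U) (x := x)
      (fun i hi => Finset.mem_Icc.1 (Finset.mem_filter.1 hi).1) fun i hi => ?_
    obtain ⟨hi, hcheap⟩ := Finset.mem_filter.1 hi
    obtain ⟨h1, hi⟩ := Finset.mem_Icc.1 hi
    exact (isCheap_or_isGuessed_of_lt_stage A B hK hg (Nat.one_le_iff_ne_zero.1 h1) hi
      (hi.trans_lt hlt)).resolve_left hcheap x hx
  have hcard := Finset.card_filter_add_card_filter_not (s := Finset.Icc 1 (2 ^ g.logStages))
    (IsCheap K g)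
  have hpow := mul_pow_sub_one (Nat.one_le_iff_ne_zero.1 hg.one_le_logStages) 2
  rw [Nat.card_Icc] at hcard
  omega

theorem exists_stage_eq_succ {r : ℕ} (htr : t ≤ r)
    (h : Settled A B g r (stage A B g t) (inPlay A B g t)) :
    ∃ r, stage A B g r = stage A B g t + 1 := by
  induction htr using Nat.decreasingInduction with
  | self => exact ⟨r + 1, by rw [stage_succ, if_pos h]⟩
  | of_succ t _ ih =>
    have hstage := stage_succ A B g t
    have hinPlay := inPlay_succ A B g t
    split_ifs at hstage hinPlay
    · exact ⟨t + 1, hstage⟩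
    · rw [hstage, hinPlay] at ih
      exact ih h

theorem exists_mem_inPlay_not_isGuessed (hK : ∀ x, complexity V x [] = K x)
    (hlaunched : Launched A g) (hbdd : BddAbove (Set.range (stage A B g))) :
    ∃ t, stage A B g t ≠ 0 ∧ ∃ x ∈ inPlay A B g t,
      g.lower (stage A B g t) ≤ K x ∧ ¬ IsGuessed U g (stage A B g t) x := by
  obtain ⟨t, ht⟩ := Nat.sSup_mem (Set.range_nonempty (stage A B g)) hbdd
  have hmax (r : ℕ) : stage A B g r ≤ stage A B g t := ht ▸ le_csSup hbdd ⟨r, rfl⟩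
  have h0 : stage A B g t ≠ 0 := fun h0 => by
    obtain ⟨r, hr⟩ := hlaunched
    have hr0 : stage A B g r = 0 := Nat.le_zero.1 (h0 ▸ hmax r)
    have hsucc := hmax (r + 1)
    have hsettled : Settled A B g r 0 (inPlay A B g r) := Or.inl ⟨rfl, hr⟩
    rw [stage_succ, hr0, if_pos hsettled, h0] at hsucc
    exact absurd hsucc (by decide)
  refine ⟨t, h0, ?_⟩
  by_contra! hall
  have hsettled : ∀ᶠ r in Filter.atTop, Settled A B g r (stage A B g t) (inPlay A B g t) :=
    eventually_settled A B hK h0 fun x hx => (lt_or_ge _ _).imp_right (hall x hx)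
  obtain ⟨r, hr, htr⟩ := (hsettled.and (Filter.eventually_ge_atTop t)).exists
  obtain ⟨r', hr'⟩ := exists_stage_eq_succ A B htr hr
  exact absurd (hmax r') (by omega)

theorem exists_le_complexity_bits (hK : ∀ x, complexity V x [] = K x) (hg : g.Large)
    (hlaunched : Launched A g)
    (hmass : ∑ x ∈ (strings g.length).toFinset, (2⁻¹ : ℝ≥0∞) ^ K x ≤ 2 * 2⁻¹ ^ g.deficit)
    (hserved : ∀ q x l, gameRequest A B q = some (x, l) → K x ≤ l + g.slack) :
    ∃ x : List Bool, x.length = g.length ∧ g.length ≤ 2 * K x ∧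
      (g.logStages - 1 : ℕ) ≤ complexity U (K x).bits x := by
  have hstage := stage_le_two_pow A B hK hg hmass
  obtain ⟨t, h0, x, hx, hlower, hguessed⟩ := exists_mem_inPlay_not_isGuessed A B hK hlaunched
    ⟨2 ^ g.logStages, Set.forall_mem_range.2 hstage⟩
  have hrange : K x ∈ g.range (stage A B g t) := by
    obtain ⟨q, hq⟩ := exists_gameRequest_eq A B hx h0 (hstage t)
    exact ⟨hlower, (hserved q x _ hq).trans_lt (hg.requestLength_add_slack_lt (hstage t))⟩
  refine ⟨x, length_of_mem_inPlay A B hx, ?_, not_lt.1 fun hlt => hguessed ?_⟩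
  · exact (hg.length_le_two_mul_lower (hstage t)).trans (Nat.mul_le_mul_left 2 hlower)
  · simp only [complexity, iInf_lt_iff, Nat.cast_lt] at hlt
    obtain ⟨q, hq, hlen⟩ := hlt
    exact ⟨q, hlen, _, hq, (lsbVal_bits _).symm ▸ hrange⟩

end Play

theorem exists_length_eq_le_complexity (U : Machine) (y : List Bool) (n : ℕ) :
    ∃ x : List Bool, x.length = n ∧ n ≤ complexity U x y := by
  classical
  by_contra! h
  simp only [complexity, iInf_lt_iff, Nat.cast_lt] at h
  choose! p hp hlen using h
  have hp_inj : Set.InjOn p (strings n).toFinset := fun x hx z hz hxz =>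
    Part.mem_unique (hp x (by simpa [mem_strings] using hx))
      (hxz ▸ hp z (by simpa [mem_strings] using hz))
  have hcard := card_lt_two_pow (F := (strings n).toFinset.image p) <|
    Finset.forall_mem_image.2 fun x hx => hlen x (mem_strings.1 (List.mem_toFinset.1 hx))
  rw [Finset.card_image_of_injOn hp_inj, List.toFinset_card_of_nodup (nodup_strings n),
    length_strings] at hcard
  exact hcard.false

theorem exists_log_le_complexity_bits_add {U V : Machine} (hU : Partrec₂ U)
    (hV : IsPrefixOptimal V) :
    ∃ c : ℕ, ∀ n : ℕ, ∃ (x : List Bool) (k : ℕ), x.length = n ∧ complexity V x [] = k ∧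
      n ≤ 2 * k ∧ Nat.log 2 n ≤ complexity U k.bits x + c := by
  obtain ⟨A⟩ := nonempty_approximation hV.1
  obtain ⟨B⟩ := nonempty_approximation hU
  choose K hK using fun x => hV.exists_complexity_eq x []
  obtain ⟨c, hc⟩ := hV.exists_complexity_le (primrec_gameRequest A B).to_comp
    (tsum_requestWeight_ne_top A B hV.2.1)
  have hserved (q : Params × ℕ × List Bool) (x : List Bool) (l : ℕ)
      (hq : gameRequest A B q = some (x, l)) : K x ≤ l + c := by
    have hle := hc q x l [] hq
    rwa [hK, Nat.cast_le] at hle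
  refine ⟨2 * c + 6, fun n => ?_⟩
  rcases lt_or_ge n (2 ^ (2 * c + 6)) with hn | hn
  · obtain ⟨x, hx, hle⟩ := exists_length_eq_le_complexity V [] n
    rw [hK, Nat.cast_le] at hle
    refine ⟨x, K x, hx, hK x, by omega, le_add_left ?_⟩
    exact_mod_cast Nat.le_of_lt (Nat.log_lt_of_lt_pow' (by positivity) hn)
  · obtain ⟨s, hlaunched, hmass⟩ := exists_launched A hV.2.1 hK c n
    obtain ⟨x, hx, hle, hbits⟩ :=
      exists_le_complexity_bits A B (g := ⟨c, n, s⟩) hK hn hlaunched hmass hserved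
    refine ⟨x, K x, hx, hK x, hle, le_trans ?_ (add_le_add_left hbits _)⟩
    norm_cast
    simp only [Params.logStages, Params.gap]
    omega

end Kolmogorov

theorem theorem2_general (U V : Kolmogorov.Machine) (hU : Partrec₂ U)
    (hUV : ∃ d : ℕ, ∀ x y : List Bool,
      Kolmogorov.complexity U x y ≤ Kolmogorov.complexity V x y + d)
    (hV : Kolmogorov.IsPrefixOptimal V) :
    ∃ c : ℕ, ∀ n : ℕ, ∃ x : List Bool, x.length = n ∧
      ∃ k l m : ℕ,
        Kolmogorov.complexity V x [] = k ∧
        Kolmogorov.complexity U k.bits x = l ∧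
        Kolmogorov.complexity V k.bits x = m ∧
        Real.logb 2 n - c ≤ l ∧
        (n : ℝ) / 2 ≤ k ∧
        Real.logb 2 n - c ≤ m := by
  obtain ⟨c, hc⟩ := Kolmogorov.exists_log_le_complexity_bits_add hU hV
  obtain ⟨d, hd⟩ := hUV
  refine ⟨c + d + 1, fun n => ?_⟩
  obtain ⟨x, k, hx, hk, hn, hlog⟩ := hc n
  obtain ⟨m, hm⟩ := hV.exists_complexity_eq k.bits x
  have hle := hd k.bits x
  rw [hm] at hle
  obtain ⟨l, hl⟩ := ENat.ne_top_iff_exists.1 (ne_top_of_le_ne_top (ENat.natCast_ne_top (m + d)) hle)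
  rw [← hl] at hle hlog
  have hfloor : Real.logb 2 n < Nat.log 2 n + 1 := by
    have hfloor := Nat.lt_floor_add_one (Real.logb (2 : ℕ) n)
    rwa [Real.natFloor_logb_natCast, Nat.cast_ofNat] at hfloor
  have hlog : (Nat.log 2 n : ℝ) ≤ l + c := by exact_mod_cast hlog
  have hle : (l : ℝ) ≤ m + d := by exact_mod_cast hle
  have hn : (n : ℝ) ≤ 2 * k := by exact_mod_cast hn
  refine ⟨x, hx, k, l, m, hk, hl.symm, hm, ?_, ?_, ?_⟩ <;> push_cast <;> linarith

/-- `U` defines plain complexity, `V` defines prefix-free complexity; the number `k` is the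
prefix-free complexity of `x`, and it is presented to the machines in binary, as `k.bits`. -/
theorem theorem2 (U V : Kolmogorov.Machine)
    (hU : Kolmogorov.IsOptimal U) (hV : Kolmogorov.IsPrefixOptimal V) :
    ∃ c : ℕ, ∀ n : ℕ, ∃ x : List Bool, x.length = n ∧
      ∃ k l m : ℕ,
        Kolmogorov.complexity V x [] = k ∧
        Kolmogorov.complexity U k.bits x = l ∧
        Kolmogorov.complexity V k.bits x = m ∧
        Real.logb 2 n - c ≤ l ∧
        (n : ℝ) / 2 ≤ k ∧
        Real.logb 2 n - c ≤ m :=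
  theorem2_general U V hU.1 (hU.2 V hV.1) hV
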